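/- Let $N\ge 1$. Let $K$ be the $3N$-gasket, i.e. the quotient of the space of infinite words in the letters $1,\dots,3N$ by the equivalence relation generated by the identifications $w\,i\,(2N)\,N N N\cdots \sim w\,j\,(3N)\,N N N\cdots$ ($w$ a finite word, $i\equiv j+1 \bmod 3N$). Let $F_i:K\to K$ be the map that prepends the letter $i$, let $v_1$ be the class of $NNN\cdots$, and put $v_k=F_{kN}(v_1)$ for $k=2,3$, $V_0=\{v_1,v_2,v_3\}$, $V_{n+1}=\bigcup_{i=1}^{3N}F_i(V_n)$. Make $V_n$ a graph by joining distinct points $x,y$ if both lie in $F_{i_1}\circ\cdots\circ F_{i_n}(V_0)$ for some $i_1,\dots,i_n$, and let $\Delta_n$ be its graph Laplacian, $\Delta_nf(x)=f(x)-\frac1{d_x}\sum_{y\sim x}f(y)$, where $d_x$ is the degree of $x$. Let $T_N$, $U_{N-1}$ be the Chebyshev polynomials of the first and second kind, let $$R(z)=\begin{cases}\dfrac{(z-1)\sqrt z\,U_{N-1}(\sqrt z)\,\bigl(2T_N(1-2z)+2U_{N-1}(1-2z)+1\bigr)}{T_N(\sqrt z)} & N \text{ even},\\[2ex] \dfrac{\sqrt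 z\,T_N(\sqrt z)\,\bigl(2T_N(1-2z)+2U_{N-1}(1-2z)+1\bigr)}{U_{N-1}(\sqrt z)} & N\text{ odd},\end{cases}$$ a rational function of $z\in\mathbb C$, and let $\mathcal A=\{z\in\mathbb C: 2T_N(1-2z)+2U_{N-1}(1-2z)+1=0\}$. For $m\ge 0$ and $S\subseteq\mathbb C$, $R^{-m}(S)$ denotes the preimage of $S$ under the $m$-th iterate $R^m$ of $R$. Then for every $n\ge0$, $\Delta_n$ is a matrix of dimension $\dfrac{3N+(6N-3)(3N)^n}{3N-1}$, and its set of eigenvalues is $$\{0,3/2\}\ \cup\ \bigcup_{m=0}^{n-1}R^{-m}\Bigl(\bigl\{\sin^2\tfrac{j\pi}{3N}\bigr\}_{j=1}^{3N-1}\Bigr)\ \cup\ \bigcup_{m=0}^{n-2}R^{-m}(\mathcal A).$$ The multiplicities are as follows. (i) The multiplicity of $0$ is $1$, and the multiplicity of $3/2$ is $\dfrac{3N+(3N-2)(3N)^n}{3N-1}$. (ii) If $0\le m\le n-1$ and $R^m(z)=\sin^2\frac{k\pi}{3N}$ with $1\le k\le 3N-1$, then the multiplicity of $z$ is $\dfrac{3N+(3N-2)(3N)^{n-m-1}}{3N-1}$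 if $3\nmid k$; it is $(3N)^{n-m-1}+1$ if $3\mid k$ and $2k\ne 3N$; and it is $1$ if $2k=3N$ (which can occur only for even $N$, and means $R^m(z)=1$). (iii) If $0\le m\le n-1$ and $R^m(z)\in\mathcal A$, then the multiplicity of $z$ is $\dfrac{(3N)^{n-m-1}-1}{3N-1}$ (multiplicity $0$, for $m=n-1$, means that $z$ is not an eigenvalue). -/

import Mathlib

open Polynomial

namespace GasketSpectrum

/-- Infinite words over the alphabet `{1, …, 3N}`, whose letters are represented by their residues
modulo `3N` (so that the letter `3N` is `0`). -/
abbrev Words (N : ℕ) : Type := ℕ → ZMod (3 * N)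

/-- The infinite word `i s₀ s₁ s₂ …`. -/
def prepend {N : ℕ} (i : ZMod (3 * N)) (s : Words N) : Words N
  | 0 => i
  | k + 1 => s k

/-- The infinite word `N N N …`. -/
def constN (N : ℕ) : Words N := fun _ => (N : ZMod (3 * N))

/-- The identifications `w i (2N) N N N … ∼ w j (3N) N N N …`, for a finite word `w`
and letters `i ≡ j + 1 mod 3N`. -/
inductive Glue (N : ℕ) : Words N → Words N → Prop
  | glue (w : List (ZMod (3 * N))) (i j : ZMod (3 * N)) (h : i = j + 1) :
      Glue N
        (w.foldr prepend (prepend i (prepend ((2 * N : ℕ) : ZMod (3 * N)) (constN N))))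
        (w.foldr prepend (prepend j (prepend ((3 * N : ℕ) : ZMod (3 * N)) (constN N))))

/-- The `3N`-gasket `K`: the quotient of the space of infinite words by the equivalence relation
generated by the identifications above. -/
def Gasket (N : ℕ) : Type := Quot (Glue N)

/-- The contractions `F_i : K → K`, induced by prepending the letter `i`. -/
def F (N : ℕ) (i : ZMod (3 * N)) : Gasket N → Gasket N :=
  Quot.map (prepend i) (by
    rintro _ _ ⟨w, a, b, h⟩
    exact Glue.glue (i :: w) a b h)

/-- `F_w = F_{i₁} ∘ ⋯ ∘ F_{iₙ}` for a finite word `w = i₁ ⋯ iₙ`. -/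
def Fw (N : ℕ) (w : List (ZMod (3 * N))) (x : Gasket N) : Gasket N := w.foldr (F N) x

/-- The boundary points: `v₁` is the class of `N N N …`, and `v_k = F_{kN} (v₁)` for `k = 2, 3`. -/
def v₁ (N : ℕ) : Gasket N := Quot.mk _ (constN N)

/-- See `v₁`. -/
def v₂ (N : ℕ) : Gasket N := F N ((2 * N : ℕ) : ZMod (3 * N)) (v₁ N)

/-- See `v₁`. -/
def v₃ (N : ℕ) : Gasket N := F N ((3 * N : ℕ) : ZMod (3 * N)) (v₁ N)

/-- The finite approximations `V₀ = {v₁, v₂, v₃}` and `V_{n+1} = ⋃ᵢ F_i (V_n)` of `K`. -/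
def V (N : ℕ) : ℕ → Set (Gasket N)
  | 0 => {v₁ N, v₂ N, v₃ N}
  | n + 1 => ⋃ i : ZMod (3 * N), F N i '' V N n

theorem V_finite (N : ℕ) [NeZero N] (n : ℕ) : (V N n).Finite := by
  induction n with
  | zero => simp [V]
  | succ n ih => exact Set.finite_iUnion fun i => ih.image _

noncomputable instance (N : ℕ) [NeZero N] (n : ℕ) : Fintype (V N n) := (V_finite N n).fintype

/-- The `n`-th approximating graph: distinct points of `V_n` are adjacent when they lie in a
common cell `F_w (V₀)` with `w` a word of length `n`. -/
def graph (N n : ℕ) : SimpleGraph (V N n) where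
  Adj x y := x ≠ y ∧ ∃ w : List (ZMod (3 * N)), w.length = n ∧
    (x : Gasket N) ∈ Fw N w '' V N 0 ∧ (y : Gasket N) ∈ Fw N w '' V N 0
  symm := ⟨fun _ _ ⟨hne, w, hw, hx, hy⟩ => ⟨hne.symm, w, hw, hy, hx⟩⟩
  loopless := ⟨fun _ h => h.1 rfl⟩

open Classical in
/-- The graph Laplacian `Δ_n f (x) = f x - (1 / d_x) ∑_{y ∼ x} f y` on real functions on `V_n`. -/
noncomputable def laplacian (N : ℕ) [NeZero N] (n : ℕ) :
    (V N n → ℝ) →ₗ[ℝ] (V N n → ℝ) where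
  toFun f x := f x - 1 / ((graph N n).degree x : ℝ) * ∑ y ∈ (graph N n).neighborFinset x, f y
  map_add' f g := by
    funext x
    simp only [Pi.add_apply, Finset.sum_add_distrib]
    ring
  map_smul' c f := by
    funext x
    simp only [Pi.smul_apply, smul_eq_mul, RingHom.id_apply, ← Finset.mul_sum]
    ring

open Classical in
/-- The matrix of `Δ_n`. -/
noncomputable def laplacianMatrix (N : ℕ) [NeZero N] (n : ℕ) : Matrix (V N n) (V N n) ℝ :=
  LinearMap.toMatrix' (laplacian N n)

open Classical in
/-- The matrix of `Δ_n`, acting on complex vectors. -/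
noncomputable def complexLaplacian (N : ℕ) [NeZero N] (n : ℕ) :
    Module.End ℂ (V N n → ℂ) :=
  Matrix.toLin' ((laplacianMatrix N n).map (algebraMap ℝ ℂ))

/-- `σ(Δ_n)`: the set of all complex eigenvalues of the matrix of `Δ_n`. -/
def eigenvalues (N : ℕ) [NeZero N] (n : ℕ) : Set ℂ :=
  {z | (complexLaplacian N n).HasEigenvalue z}

/-- The multiplicity of `z` as an eigenvalue of `Δ_n`, i.e. the dimension of the `z`-eigenspace. -/
noncomputable def mult (N : ℕ) [NeZero N] (n : ℕ) (z : ℂ) : ℕ :=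
  Module.finrank ℂ ((complexLaplacian N n).eigenspace z)

/-- Chebyshev polynomial of the first kind, `T_N (z)`. -/
noncomputable def chebT (N : ℕ) (z : ℂ) : ℂ := (Chebyshev.T ℂ (N : ℤ)).eval z

/-- Chebyshev polynomial of the second kind of index one less, `U_{N-1} (z)`. -/
noncomputable def chebU (N : ℕ) (z : ℂ) : ℂ := (Chebyshev.U ℂ ((N : ℤ) - 1)).eval z

/-- The polynomial `2 T_N (1 - 2 z) + 2 U_{N-1} (1 - 2 z) + 1`. -/
noncomputable def polyA (N : ℕ) (z : ℂ) : ℂ :=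
  2 * chebT N (1 - 2 * z) + 2 * chebU N (1 - 2 * z) + 1

/-- The set `𝒜` of zeros of `2 T_N (1 - 2 z) + 2 U_{N-1} (1 - 2 z) + 1`. -/
def setA (N : ℕ) : Set ℂ := {z | polyA N z = 0}

/-- The principal square root (any other choice gives the same `R`). -/
noncomputable def csqrt (z : ℂ) : ℂ := z ^ (1 / 2 : ℂ)

/-- The numerator of `R`. -/
noncomputable def numR (N : ℕ) (z : ℂ) : ℂ :=
  if Even N then (z - 1) * csqrt z * chebU N (csqrt z) * polyA N z
  else csqrt z * chebT N (csqrt z) * polyA N z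

/-- The denominator of `R`; it has no zero in common with the numerator, so its zeros are the
poles of `R`. -/
noncomputable def denR (N : ℕ) (z : ℂ) : ℂ :=
  if Even N then chebT N (csqrt z) else chebU N (csqrt z)

/-- The values of the rational function `R` (meaningful where `denR N z ≠ 0`). -/
noncomputable def R (N : ℕ) (z : ℂ) : ℂ := numR N z / denR N z

/-- `R^{-m} (S)` for the `m`-th iterate of the rational function `R`: the set of those `z` for which
`z, R z, …, R^{m-1} z` are not poles of `R`, and `R^m z ∈ S`. -/
def iterPreimage (N : ℕ) : ℕ → Set ℂ → Set ℂ
  | 0, S => S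
  | m + 1, S => {z | denR N z ≠ 0 ∧ R N z ∈ iterPreimage N m S}

/-- The number `sin² (k π / (3N))`. -/
noncomputable def sinSq (N k : ℕ) : ℂ := ((Real.sin (k * Real.pi / (3 * N)) ^ 2 : ℝ) : ℂ)

end GasketSpectrum

namespace GasketSpectrum

/-! ### Linear algebra -/

/-! The vertices of level `n` are the orbits of an involution σ (`glue N n`) on pairs (cell,
corner), and passing to level `n + 1` replaces every cell by a ring of 3N cells (`subdivide`). A
function on vertices is a σ-invariant function h on corners, and Δh = zh says that the sums of h
over the two cells meeting at a corner (the same cell twice at the boundary) add up to 2(3 - 2z)h.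
If z ≠ 3/2, h is recovered from its cell sums p, and the equation becomes Σ p(neighbours) = (3 -
4z)p on cells, a cell being its own neighbour across an unglued corner. If z = 3/2, all cell sums
vanish. Thus `mult` reduces to `cellMult`.

The cell equation can be decimated. With x = 1 - 2z it reads S(i+1) + S(i-1) = 2x S(i) on the arcs
of a ring between its corner subcells, so its solutions there are combinations of Chebyshev values.
Write T = T_N(x) and U = U_{N-1}(x). If U ≠ 0, eliminating all but the values s at the corner
subcells leaves (2T + 1 + U)s = P + U s∘σ, where P is the sum of s over the cell. The parts even and
odd under σ satisfy (2T + 1)(s + s') = P + P' and (2T + 2U + 1)(s - s') = P - P', primes denoting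
composition with σ. If neither factor vanishes, P determines s and solves the cell equation of the
level below, with z replaced by the y such that 2Uy = (1 - T)(2T + 2U + 1). By `R_mul` this y is
R(z), so generically `cellMult N (n + 1) z = cellMult N n (R N z)`.

The exceptional z produce the listed multiplicities. If 2T + 1 = 0, the solutions are the even
functions with vanishing cell sums; if 2T + 2U + 1 = 0, the odd ones; if U = 0 and T = 1, one free
value per cell and one global constant; if U = 0 and T = -1 (a pole of R), only zero. The dimensions
follow from rank-nullity and the number of vertices. The z ≠ 0 with T = 1 or T = -1/2 are exactly
the numbers sin²(jπ/3N). Finally, R sends exceptional non-poles to 0 or 3/2, and neither number lies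
in any of the iterated preimages, so every step of an orbit before it reaches its target set is
generic (`cellMult_add`). Conversely a nonzero eigenfunction can be pushed down until an exceptional
value occurs or level 0 leaves only z = 0 (`mem_of_cellMult_ne_zero`). -/

theorem finrank_eq_of_bijOn {E E' : Type*} [AddCommGroup E] [Module ℂ E] [AddCommGroup E']
    [Module ℂ E'] (A : Submodule ℂ E) (B : Submodule ℂ E') (f : E →ₗ[ℂ] E')
    (hf : ∀ a ∈ A, f a ∈ B) (inj : ∀ a ∈ A, f a = 0 → a = 0)
    (surj : ∀ b ∈ B, ∃ a ∈ A, f a = b) : Module.finrank ℂ A = Module.finrank ℂ B := by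
  refine (LinearEquiv.ofBijective (f.restrict hf) ⟨?_, ?_⟩).finrank_eq
  · rw [injective_iff_map_eq_zero]
    rintro ⟨a, ha⟩ h
    exact Subtype.ext (inj a ha (congrArg Subtype.val h))
  · rintro ⟨b, hb⟩
    obtain ⟨a, ha, rfl⟩ := surj b hb
    exact ⟨⟨a, ha⟩, rfl⟩

theorem finrank_eq_of_bijOn_top {E E' : Type*} [AddCommGroup E] [Module ℂ E] [AddCommGroup E']
    [Module ℂ E'] (A : Submodule ℂ E) (f : E →ₗ[ℂ] E') (inj : ∀ a ∈ A, f a = 0 → a = 0)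
    (surj : ∀ b, ∃ a ∈ A, f a = b) : Module.finrank ℂ A = Module.finrank ℂ E' := by
  rw [← finrank_top ℂ E']
  exact finrank_eq_of_bijOn A ⊤ f (fun _ _ => trivial) inj fun b _ => surj b

/-- The matrices are transposes of each other. This moves the rank of the cell-sum map to its
adjoint, whose kernel is visible from connectedness. -/
theorem finrank_range_eq_of_adjoint {X Y : Type*} [Fintype X] [Fintype Y]
    (A : (X → ℂ) →ₗ[ℂ] (Y → ℂ)) (B : (Y → ℂ) →ₗ[ℂ] (X → ℂ))
    (h : ∀ f g, ∑ y, A f y * g y = ∑ x, f x * B g x) :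
    Module.finrank ℂ (LinearMap.range A) = Module.finrank ℂ (LinearMap.range B) := by
  classical
  have hB : LinearMap.toMatrix' B = (LinearMap.toMatrix' A).transpose := by
    ext x y
    have := h (Pi.single x 1) (Pi.single y 1)
    simpa [LinearMap.toMatrix'_apply, Pi.single_apply, eq_comm] using this.symm
  have h1 := Matrix.rank_transpose (LinearMap.toMatrix' A)
  rw [← hB, Matrix.rank, Matrix.rank, ← Matrix.toLin'_apply', ← Matrix.toLin'_apply',
    Matrix.toLin'_toMatrix', Matrix.toLin'_toMatrix'] at h1
  exact h1.symm

/-! ### The ring of `3N` cells -/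

/-- The position, in the ring of `3N` subcells of a cell, of the subcell at the given corner. -/
def pos (N : ℕ) (k : Fin 3) : ZMod (3 * N) := ((k.val * N : ℕ) : ZMod (3 * N))

section

variable {N : ℕ}

theorem pos_add_one (k : Fin 3) : pos N (k + 1) = pos N k + N := by
  fin_cases k
  · simp [pos]
  · change ((2 * N : ℕ) : ZMod (3 * N)) = ((1 * N : ℕ) : ZMod (3 * N)) + N
    push_cast
    ring
  · change ((0 * N : ℕ) : ZMod (3 * N)) = ((2 * N : ℕ) : ZMod (3 * N)) + N
    have h := ZMod.natCast_self (3 * N)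
    push_cast at h ⊢
    linear_combination -h

theorem val_pos_add [NeZero N] (k : Fin 3) {j : ℕ} (hj : j < N) :
    (pos N k + j).val = k.val * N + j := by
  rw [pos, ← Nat.cast_add]
  apply ZMod.val_cast_of_lt
  have : k.val ≤ 2 := by omega
  nlinarith

theorem pos_add_inj [NeZero N] {k l : Fin 3} {i j : ℕ} (hi : i < N) (hj : j < N)
    (h : pos N k + i = pos N l + j) : k = l ∧ i = j := by
  have h' := congrArg ZMod.val h
  rw [val_pos_add k hi, val_pos_add l hj] at h'
  have h1 := congrArg (· / N) h'
  have h2 := congrArg (· % N) h'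
  have hN : 0 < N := NeZero.pos N
  simp only [mul_comm _ N, Nat.mul_add_div hN, Nat.div_eq_of_lt hi, Nat.div_eq_of_lt hj,
    Nat.mul_add_mod, Nat.mod_eq_of_lt hi, Nat.mod_eq_of_lt hj, add_zero] at h1 h2
  exact ⟨Fin.ext h1, h2⟩

theorem pos_injective [NeZero N] : Function.Injective (pos N) := fun k l h =>
  (pos_add_inj (i := 0) (j := 0) (NeZero.pos N) (NeZero.pos N) (by simpa using h)).1

theorem div_lt_three [NeZero N] (i : ZMod (3 * N)) : i.val / N < 3 := by
  have : i.val < 3 * N := ZMod.val_lt i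
  exact Nat.div_lt_of_lt_mul (by linarith)

theorem eq_pos_add [NeZero N] (i : ZMod (3 * N)) :
    i = pos N ⟨i.val / N, div_lt_three i⟩ + ((i.val % N : ℕ) : ZMod (3 * N)) := by
  apply ZMod.val_injective
  rw [val_pos_add _ (Nat.mod_lt _ (NeZero.pos N))]
  exact (Nat.div_add_mod' _ _).symm

theorem exists_eq_pos_add [NeZero N] (i : ZMod (3 * N)) :
    ∃ (k : Fin 3) (j : ℕ), j < N ∧ i = pos N k + j :=
  ⟨_, _, Nat.mod_lt _ (NeZero.pos N), eq_pos_add i⟩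

theorem pos_add_ne_pos [NeZero N] (k l : Fin 3) {j : ℕ} (h0 : 0 < j) (hj : j < N) :
    pos N l ≠ pos N k + j := fun h => by
  have := (pos_add_inj (k := l) (l := k) (i := 0) (NeZero.pos N) hj (by simpa using h)).2
  omega

/-- A function on the ring can be prescribed on the three closed arcs between corners. -/
theorem exists_ring_function [NeZero N] (f : Fin 3 → ℕ → ℂ) (hf : ∀ k, f k N = f (k + 1) 0) :
    ∃ S : ZMod (3 * N) → ℂ, ∀ (k : Fin 3) (j : ℕ), j ≤ N → S (pos N k + j) = f k j := by
  refine ⟨fun i => f ⟨i.val / N, div_lt_three i⟩ (i.val % N), ?_⟩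
  have key : ∀ (k : Fin 3) (j : ℕ), j < N →
      f ⟨(pos N k + (j : ZMod (3 * N))).val / N, div_lt_three _⟩
        ((pos N k + (j : ZMod (3 * N))).val % N) = f k j := by
    intro k j hj
    obtain ⟨h1, h2⟩ := pos_add_inj (Nat.mod_lt _ (NeZero.pos N)) hj
      (eq_pos_add (pos N k + (j : ZMod (3 * N)))).symm
    rw [h1, h2]
  intro k j hj
  rcases hj.lt_or_eq with hj | rfl
  · exact key k j hj
  · have := key (k + 1) 0 (NeZero.pos j)
    rw [Nat.cast_zero, add_zero] at this
    rw [← pos_add_one, hf]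
    exact this

theorem ring_two_ne_zero [NeZero N] : (2 : ZMod (3 * N)) ≠ 0 := fun h => by
  have : ((2 : ℕ) : ZMod (3 * N)) = 0 := by exact_mod_cast h
  rw [ZMod.natCast_eq_zero_iff] at this
  have := Nat.le_of_dvd (by norm_num) this
  have := NeZero.pos N
  omega

theorem ring_one_ne_zero [NeZero N] : (1 : ZMod (3 * N)) ≠ 0 := fun h => by
  apply ring_two_ne_zero (N := N)
  rw [← one_add_one_eq_two, h, add_zero]

theorem sum_ring_eq [NeZero N] {R : Type*} [Ring R] (f : ZMod (3 * N) → R)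
    (hf : ∀ i, (∀ k, pos N k ≠ i) → f i = 1) :
    ∑ i, f i = 3 * N - 3 + ∑ k, f (pos N k) := by
  classical
  have h1 : ∑ i, (f i - 1) = ∑ k, (f (pos N k) - 1) := by
    rw [← Finset.sum_image (f := fun i => f i - 1) (s := Finset.univ)
      (fun a _ b _ h => pos_injective h)]
    refine (Finset.sum_subset (Finset.subset_univ _) fun i _ hi => ?_).symm
    rw [hf i fun k hk => hi (Finset.mem_image.2 ⟨k, Finset.mem_univ _, hk⟩), sub_self]
  rw [Finset.sum_sub_distrib, Finset.sum_sub_distrib] at h1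
  simp only [Finset.sum_const, Finset.card_univ, ZMod.card, Fintype.card_fin, nsmul_eq_mul,
    mul_one] at h1
  push_cast at h1
  rw [← sub_add_cancel (∑ i, f i) (3 * (N : R)), h1]
  abel

/-! ### Gluings of triangular cells -/

variable {W : Type}

/-- The gluing of the subcells obtained by replacing every cell by a ring of `3N` cells: the
consecutive cells of a ring share a corner, and the subcells at the corners of the cells are glued
as these cells were. A corner that is not glued is a fixed point. -/
noncomputable def subdivide (N : ℕ) (σ : W × Fin 3 → W × Fin 3) :
    (W × ZMod (3 * N)) × Fin 3 → (W × ZMod (3 * N)) × Fin 3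
  | ((c, i), 0) => ((c, i + 1), 2)
  | ((c, i), 1) =>
    open Classical in
    if h : ∃ k, pos N k = i then (((σ (c, h.choose)).1, pos N (σ (c, h.choose)).2), 1)
    else ((c, i), 1)
  | ((c, i), 2) => ((c, i - 1), 0)

section

variable (σ : W × Fin 3 → W × Fin 3)

@[simp] theorem subdivide_zero (c : W) (i : ZMod (3 * N)) :
    subdivide N σ ((c, i), 0) = ((c, i + 1), 2) := rfl

@[simp] theorem subdivide_two (c : W) (i : ZMod (3 * N)) :
    subdivide N σ ((c, i), 2) = ((c, i - 1), 0) := rfl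

@[simp] theorem subdivide_pos [NeZero N] (c : W) (k : Fin 3) :
    subdivide N σ ((c, pos N k), 1) = (((σ (c, k)).1, pos N (σ (c, k)).2), 1) := by
  have h : ∃ l, pos N l = pos N k := ⟨k, rfl⟩
  have h' := pos_injective h.choose_spec
  rw [subdivide, dif_pos h, h']

theorem subdivide_of_ne (c : W) {i : ZMod (3 * N)} (h : ∀ k, pos N k ≠ i) :
    subdivide N σ ((c, i), 1) = ((c, i), 1) := by
  rw [subdivide, dif_neg]
  simpa using h

theorem fin_three_cases (k : Fin 3) : k = 0 ∨ k = 1 ∨ k = 2 := by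
  fin_cases k <;> simp

/-- The properties of a gluing that make the cells into a triangle complex: a corner is glued to
at most one other corner, distinct corners of a cell are not glued, and two cells have at most one
corner in common. -/
structure IsGluing (σ : W × Fin 3 → W × Fin 3) : Prop where
  involutive : ∀ a, σ (σ a) = a
  eq_of_same : ∀ c k l, σ (c, k) = (c, l) → k = l
  eq_of_two : ∀ c k l, (σ (c, k)).1 = (σ (c, l)).1 → k ≠ l → (σ (c, k)).1 = c

variable {σ}

/-- In a ring the neighbours i + 1, i - 1 and i are distinct because 3N ≥ 3. Corner 1 of a subcell
never leads to another subcell of the same ring, since this would glue two corners of the original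
cell. -/
theorem IsGluing.subdivide [NeZero N] (h : IsGluing σ) : IsGluing (subdivide N σ) where
  involutive := by
    rintro ⟨⟨c, i⟩, k⟩
    rcases fin_three_cases k with rfl | rfl | rfl
    · simp
    · by_cases hi : ∃ k, pos N k = i
      · obtain ⟨k, rfl⟩ := hi
        simp [h.involutive]
      · push Not at hi
        rw [subdivide_of_ne σ c hi, subdivide_of_ne σ c hi]
    · simp
  eq_of_same := by
    rintro ⟨c, i⟩ k l hkl
    rcases fin_three_cases k with rfl | rfl | rfl
    · simp [ring_one_ne_zero] at hkl
    · by_cases hi : ∃ k, pos N k = i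
      · obtain ⟨k, rfl⟩ := hi
        rw [subdivide_pos] at hkl
        exact congrArg Prod.snd hkl
      · push Not at hi
        rw [subdivide_of_ne σ c hi] at hkl
        exact congrArg Prod.snd hkl
    · simp [ring_one_ne_zero] at hkl
  eq_of_two := by
    have h02 : ∀ i : ZMod (3 * N), i + 1 ≠ i - 1 := fun i hi => by
      apply ring_two_ne_zero (N := N)
      linear_combination hi
    have key : ∀ (c : W) (i j : ZMod (3 * N)), i ≠ j →
        (GasketSpectrum.subdivide N σ ((c, i), 1)).1 ≠ (c, j) := by
      intro c i j hij hi'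
      by_cases hi : ∃ k, pos N k = i
      · obtain ⟨k, rfl⟩ := hi
        rw [subdivide_pos, Prod.mk.injEq] at hi'
        have := h.eq_of_same c k (σ (c, k)).2 (Prod.ext hi'.1 rfl)
        rw [← this] at hi'
        exact hij hi'.2
      · push Not at hi
        rw [subdivide_of_ne σ c hi] at hi'
        exact hij (congrArg Prod.snd hi')
    rintro ⟨c, i⟩ k l hkl hne
    rcases fin_three_cases k with rfl | rfl | rfl <;>
      rcases fin_three_cases l with rfl | rfl | rfl
    · exact absurd rfl hne
    · exact absurd hkl.symm (key c i (i + 1) (by simp [ring_one_ne_zero]))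
    · exact absurd (congrArg Prod.snd hkl) (h02 i)
    · exact absurd hkl (key c i (i + 1) (by simp [ring_one_ne_zero]))
    · exact absurd rfl hne
    · exact absurd hkl (key c i (i - 1) (by simp [eq_sub_iff_add_eq, ring_one_ne_zero]))
    · exact absurd (congrArg Prod.snd hkl).symm (h02 i)
    · exact absurd hkl.symm (key c i (i - 1) (by simp [eq_sub_iff_add_eq, ring_one_ne_zero]))
    · exact absurd rfl hne

/-- The cells are connected to each other. -/
def IsConnected (σ : W × Fin 3 → W × Fin 3) : Prop :=
  ∀ p : W → ℂ, (∀ c k, p (σ (c, k)).1 = p c) → ∀ c d, p c = p d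

theorem IsConnected.subdivide [NeZero N] (h : IsConnected σ) :
    IsConnected (subdivide N σ) := by
  intro p hp
  have h1 : ∀ c (i : ℕ), p (c, (i : ZMod (3 * N))) = p (c, 0) := by
    intro c i
    induction i with
    | zero => simp
    | succ i ih => rw [← ih, ← hp (c, (i : ZMod (3 * N))) 0]; simp
  have h2 : ∀ c (i : ZMod (3 * N)), p (c, i) = p (c, 0) := fun c i => by
    rw [← h1 c i.val, ZMod.natCast_zmod_val]
  have h3 := h (fun c => p (c, 0)) fun c k => by
    have := hp (c, pos N k) 1
    rw [subdivide_pos] at this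
    simpa [h2] using this
  rintro ⟨c, i⟩ ⟨d, j⟩
  rw [h2 c i, h2 d j]
  exact h3 c d

/-- Some corner is not glued. -/
def HasBoundary (σ : W × Fin 3 → W × Fin 3) : Prop := ∃ a, σ a = a

theorem HasBoundary.subdivide [NeZero N] (h : HasBoundary σ) :
    HasBoundary (subdivide N σ) := by
  obtain ⟨⟨c, k⟩, hk⟩ := h
  exact ⟨((c, pos N k), 1), by rw [subdivide_pos, hk]⟩

/-- The square of p is unchanged across gluings, hence constant, and at an unglued corner the
hypothesis reads 2p = 0. -/
theorem IsConnected.eq_zero_of_alternating (h : IsConnected σ) (hb : HasBoundary σ)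
    {p : W → ℂ} (hp : ∀ c k, p c + p (σ (c, k)).1 = 0) : p = 0 := by
  have h1 := h (fun c => p c ^ 2) fun c k => by
    have := hp c k
    linear_combination (p (σ (c, k)).1 - p c) * this
  obtain ⟨⟨d, k⟩, hd⟩ := hb
  have h0 : p d = 0 := by
    have := hp d k
    rw [hd] at this
    linear_combination this / 2
  ext c
  have := h1 c d
  simp only [h0] at this
  simpa using this

end

end

/-! ### Functions on the corners of a triangle complex -/

section

variable {W : Type}

/-- The sum over the corners of each cell. -/
def cornerSum (W : Type) : (W × Fin 3 → ℂ) →ₗ[ℂ] (W → ℂ) where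
  toFun h c := ∑ k, h (c, k)
  map_add' f g := by ext; simp [Finset.sum_add_distrib]
  map_smul' r f := by ext; simp [Finset.mul_sum]

@[simp] theorem cornerSum_apply (h : W × Fin 3 → ℂ) (c : W) :
    cornerSum W h c = ∑ k, h (c, k) := rfl

variable (σ : W × Fin 3 → W × Fin 3)

/-- The functions on corners that are multiplied by `ε` under the gluing. -/
def signed (ε : ℂ) : Submodule ℂ (W × Fin 3 → ℂ) where
  carrier := {h | ∀ a, h (σ a) = ε * h a}
  zero_mem' := by simp
  add_mem' hf hg a := by simp [hf a, hg a, mul_add]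
  smul_mem' r f hf a := by simp [hf a, mul_left_comm]

/-- The functions multiplied by `ε` under the gluing whose sum on each cell vanishes. -/
def signedNull (ε : ℂ) : Submodule ℂ (W × Fin 3 → ℂ) :=
  signed σ ε ⊓ LinearMap.ker (cornerSum W)

variable {σ}

theorem mem_signed {ε : ℂ} {h : W × Fin 3 → ℂ} :
    h ∈ signed σ ε ↔ ∀ a, h (σ a) = ε * h a := Iff.rfl

theorem mem_signedNull {ε : ℂ} {h : W × Fin 3 → ℂ} :
    h ∈ signedNull σ ε ↔ (∀ a, h (σ a) = ε * h a) ∧ ∀ c, ∑ k, h (c, k) = 0 := by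
  rw [signedNull, Submodule.mem_inf, mem_signed, LinearMap.mem_ker, funext_iff]
  rfl

variable (σ) in
/-- The operator `1 + ε σ*` on functions on corners. -/
def symmetrize (ε : ℂ) : (W × Fin 3 → ℂ) →ₗ[ℂ] (W × Fin 3 → ℂ) :=
  LinearMap.id + ε • LinearMap.funLeft ℂ ℂ σ

@[simp] theorem symmetrize_apply (ε : ℂ) (h : W × Fin 3 → ℂ) (a : W × Fin 3) :
    symmetrize σ ε h a = h a + ε * h (σ a) := rfl

/-- Since ε² = 1, half of `symmetrize σ ε` is a projection onto `signed σ ε`. -/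
theorem range_symmetrize (hσ : IsGluing σ) {ε : ℂ} (hε : ε * ε = 1) :
    LinearMap.range (symmetrize σ ε) = signed σ ε := by
  ext h
  rw [LinearMap.mem_range, mem_signed]
  constructor
  · rintro ⟨g, rfl⟩ a
    simp only [symmetrize_apply, hσ.involutive]
    linear_combination (-g (σ a)) * hε
  · intro hh
    refine ⟨(1 / 2 : ℂ) • h, ?_⟩
    ext a
    simp only [symmetrize_apply, Pi.smul_apply, smul_eq_mul, hh]
    linear_combination (1 / 2 * h a) * hε

theorem ker_symmetrize_neg_one : LinearMap.ker (symmetrize σ (-1)) = signed σ 1 := by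
  ext h
  rw [LinearMap.mem_ker, mem_signed, funext_iff]
  refine forall_congr' fun a => ?_
  rw [symmetrize_apply, Pi.zero_apply, one_mul]
  constructor <;> intro h <;> linear_combination -h

/-! ### Dimensions of the even and odd functions with vanishing cell sums. -/

variable [Fintype W]

theorem finrank_signed_neg_one (hσ : IsGluing σ) :
    Module.finrank ℂ (signed σ (-1)) + Module.finrank ℂ (signed σ 1) = 3 * Fintype.card W := by
  rw [← range_symmetrize hσ (by norm_num), ← ker_symmetrize_neg_one,
    LinearMap.finrank_range_add_finrank_ker, Module.finrank_fintype_fun_eq_card,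
    Fintype.card_prod, Fintype.card_fin, mul_comm]

variable (σ) in
/-- The adjoint of `cornerSum ∘ symmetrize`. -/
def spread (ε : ℂ) : (W → ℂ) →ₗ[ℂ] (W × Fin 3 → ℂ) :=
  LinearMap.funLeft ℂ ℂ Prod.fst + ε • LinearMap.funLeft ℂ ℂ (fun a => (σ a).1)

omit [Fintype W] in
@[simp] theorem spread_apply (ε : ℂ) (p : W → ℂ) (a : W × Fin 3) :
    spread σ ε p a = p a.1 + ε * p (σ a).1 := rfl

/-- Rank-nullity twice: for the cell sums restricted to `signed σ ε`, and for `spread`. The two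
ranks agree because `spread` is adjoint to the cell sums composed with the symmetrization, whose
range is all of `signed σ ε`. -/
theorem finrank_signedNull_add (hσ : IsGluing σ) {ε : ℂ} (hε : ε * ε = 1) :
    Module.finrank ℂ (signedNull σ ε) + Fintype.card W =
      Module.finrank ℂ (signed σ ε) + Module.finrank ℂ (LinearMap.ker (spread σ ε)) := by
  have h1 := LinearMap.finrank_range_add_finrank_ker (spread σ ε)
  rw [Module.finrank_fintype_fun_eq_card] at h1
  have h2 : Module.finrank ℂ (LinearMap.range (cornerSum W ∘ₗ symmetrize σ ε)) =
      Module.finrank ℂ (LinearMap.range (spread σ ε)) := by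
    apply finrank_range_eq_of_adjoint
    intro f g
    have e : Function.Bijective σ := Function.Involutive.bijective hσ.involutive
    have h3 : ∑ a, f (σ a) * g a.1 = ∑ a, f a * g (σ a).1 := by
      rw [← e.sum_comp (fun a => f a * g (σ a).1)]
      simp [hσ.involutive]
    have h4 : ∑ y, (cornerSum W ∘ₗ symmetrize σ ε) f y * g y
        = ∑ a : W × Fin 3, (f a + ε * f (σ a)) * g a.1 := by
      rw [Fintype.sum_prod_type]
      simp [Finset.sum_mul]
    rw [h4]
    simp only [spread_apply, mul_add, add_mul, Finset.sum_add_distrib, mul_assoc,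
      mul_left_comm _ ε, ← Finset.mul_sum, h3]
  have h5 := LinearMap.finrank_range_add_finrank_ker ((cornerSum W).domRestrict (signed σ ε))
  rw [LinearMap.range_domRestrict, ← range_symmetrize hσ hε, ← LinearMap.range_comp, h2,
    range_symmetrize hσ hε] at h5
  have h6 : Module.finrank ℂ (LinearMap.ker ((cornerSum W).domRestrict (signed σ ε))) =
      Module.finrank ℂ (signedNull σ ε) := by
    apply finrank_eq_of_bijOn _ _ (signed σ ε).subtype
    · rintro ⟨a, ha⟩ h
      exact ⟨ha, h⟩
    · rintro a - h
      exact Subtype.ext h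
    · rintro b ⟨h1, h2⟩
      exact ⟨⟨b, h1⟩, h2, rfl⟩
  omega

theorem finrank_even_null (hσ : IsGluing σ) (hc : IsConnected σ) (hb : HasBoundary σ) :
    Module.finrank ℂ (signedNull σ 1) + Fintype.card W = Module.finrank ℂ (signed σ 1) := by
  rw [finrank_signedNull_add hσ (by norm_num), (LinearMap.ker_eq_bot'.2 _), finrank_bot, add_zero]
  intro p hp
  refine hc.eq_zero_of_alternating hb fun c k => ?_
  simpa using congrFun hp (c, k)

omit [Fintype W] in
theorem finrank_const [Nonempty W] (A : Submodule ℂ (W → ℂ))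
    (h : ∀ p, p ∈ A ↔ ∀ c d, p c = p d) : Module.finrank ℂ A = 1 := by
  obtain ⟨c⟩ := ‹Nonempty W›
  rw [finrank_eq_of_bijOn_top A (LinearMap.proj c : (W → ℂ) →ₗ[ℂ] ℂ), Module.finrank_self]
  · intro a ha h0
    ext d
    rw [(h a).1 ha d c]
    exact h0
  · intro b
    exact ⟨fun _ => b, (h _).2 fun _ _ => rfl, rfl⟩

/-- For ε = -1 the kernel of `spread` consists of the constants, by connectedness; this is the
source of the summand 1. -/
theorem finrank_odd_null (hσ : IsGluing σ) (hc : IsConnected σ) [Nonempty W] :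
    Module.finrank ℂ (signedNull σ (-1)) + Module.finrank ℂ (signed σ 1) =
      2 * Fintype.card W + 1 := by
  have h1 := finrank_signedNull_add hσ (ε := -1) (by norm_num)
  have h2 := finrank_signed_neg_one hσ
  rw [finrank_const (LinearMap.ker (spread σ (-1)))] at h1
  · omega
  · intro p
    rw [LinearMap.mem_ker, funext_iff]
    constructor
    · intro h
      apply hc
      intro c k
      have := h (c, k)
      simp only [spread_apply, Pi.zero_apply] at this
      linear_combination -this
    · intro h a
      simp [h (σ a).1 a.1]

end

/-! ### The eigenfunctions on cells -/

section

variable {N : ℕ} {W : Type}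

/-- The functions on cells whose sums over the three neighbours of a cell (a cell being its own
neighbour across a boundary corner) are `lam` times the value at the cell. -/
def cellEigen (σ : W × Fin 3 → W × Fin 3) (lam : ℂ) : Submodule ℂ (W → ℂ) where
  carrier := {p | ∀ c, ∑ k, p (σ (c, k)).1 = lam * p c}
  zero_mem' := by simp
  add_mem' hf hg a := by simp [Finset.sum_add_distrib, hf a, hg a, mul_add]
  smul_mem' r f hf a := by simp [← Finset.mul_sum, hf a, mul_left_comm]

theorem mem_cellEigen {σ : W × Fin 3 → W × Fin 3} {lam : ℂ} {p : W → ℂ} :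
    p ∈ cellEigen σ lam ↔ ∀ c, ∑ k, p (σ (c, k)).1 = lam * p c := Iff.rfl

/-- The values `U_j (x)`. -/
noncomputable def evalU (x : ℂ) (j : ℤ) : ℂ := (Chebyshev.U ℂ j).eval x

theorem evalU_add_two (x : ℂ) (j : ℤ) :
    evalU x (j + 2) = 2 * x * evalU x (j + 1) - evalU x j := by
  simp [evalU, Chebyshev.U_add_two]

@[simp] theorem evalU_zero (x : ℂ) : evalU x 0 = 1 := by simp [evalU]
@[simp] theorem evalU_neg_one (x : ℂ) : evalU x (-1) = 0 := by simp [evalU]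
@[simp] theorem evalU_neg_two (x : ℂ) : evalU x (-2) = -1 := by simp [evalU]

/-- The pairs `(s, d)` where `s` gives the values of an eigenfunction on the subdivided complex at
the corner subcells and `d` the values at the subcells next to them. -/
def cornerData (N : ℕ) (σ : W × Fin 3 → W × Fin 3) (x : ℂ) :
    Submodule ℂ ((W × Fin 3 → ℂ) × (W × Fin 3 → ℂ)) where
  carrier := {q | ∀ c k,
    q.1 (c, k + 1) = evalU x (N - 1) * q.2 (c, k) - evalU x (N - 2) * q.1 (c, k) ∧
    2 * x * q.1 (c, k + 1) - q.2 (c, k + 1)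
      - (evalU x (N - 2) * q.2 (c, k) - evalU x (N - 3) * q.1 (c, k))
      = q.1 (σ (c, k + 1)) - q.1 (c, k + 1)}
  zero_mem' := by simp
  add_mem' hf hg c k := by
    obtain ⟨f1, f2⟩ := hf c k
    obtain ⟨g1, g2⟩ := hg c k
    simp only [Prod.fst_add, Prod.snd_add, Pi.add_apply]
    exact ⟨by linear_combination f1 + g1, by linear_combination f2 + g2⟩
  smul_mem' r f hf c k := by
    obtain ⟨f1, f2⟩ := hf c k
    simp only [Prod.smul_fst, Prod.smul_snd, Pi.smul_apply, smul_eq_mul]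
    exact ⟨by linear_combination r * f1, by linear_combination r * f2⟩

theorem mem_cornerData {σ : W × Fin 3 → W × Fin 3} {x : ℂ} {s d : W × Fin 3 → ℂ} :
    (s, d) ∈ cornerData N σ x ↔ ∀ c k,
    s (c, k + 1) = evalU x (N - 1) * d (c, k) - evalU x (N - 2) * s (c, k) ∧
    2 * x * s (c, k + 1) - d (c, k + 1) - (evalU x (N - 2) * d (c, k) - evalU x (N - 3) * s (c, k))
      = s (σ (c, k + 1)) - s (c, k + 1) := Iff.rfl

variable [NeZero N] {σ : W × Fin 3 → W × Fin 3} {x : ℂ}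

/-- Away from the corners of the original cell, a subcell is its own third neighbour. This absorbs
the 1 in 2x + 1 and leaves the Chebyshev recurrence. -/
theorem mem_cellEigen_subdivide {S : W × ZMod (3 * N) → ℂ} :
    S ∈ cellEigen (subdivide N σ) (2 * x + 1) ↔
      (∀ c k j, 0 < j → j < N → S (c, pos N k + (j : ℕ) + 1) + S (c, pos N k + (j : ℕ) - 1)
        = 2 * x * S (c, pos N k + (j : ℕ))) ∧
      ∀ c k, 2 * x * S (c, pos N k) - S (c, pos N k + 1) - S (c, pos N k - 1)
        = S ((σ (c, k)).1, pos N (σ (c, k)).2) - S (c, pos N k) := by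
  rw [mem_cellEigen]
  constructor
  · intro h
    refine ⟨fun c k j h0 hj => ?_, fun c k => ?_⟩
    · have := h (c, pos N k + (j : ℕ))
      rw [Fin.sum_univ_three, subdivide_of_ne σ c (fun l => pos_add_ne_pos k l h0 hj)] at this
      simp only [subdivide_zero, subdivide_two] at this
      linear_combination this
    · have := h (c, pos N k)
      rw [Fin.sum_univ_three] at this
      simp only [subdivide_zero, subdivide_two, subdivide_pos] at this
      linear_combination -this
  · rintro ⟨h1, h2⟩ ⟨c, i⟩
    obtain ⟨k, j, hj, rfl⟩ := exists_eq_pos_add i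
    rw [Fin.sum_univ_three]
    rcases Nat.eq_zero_or_pos j with rfl | h0
    · have := h2 c k
      simp only [subdivide_zero, subdivide_two, subdivide_pos, Nat.cast_zero, add_zero]
      linear_combination -this
    · have := h1 c k j h0 hj
      rw [subdivide_of_ne σ c (fun l => pos_add_ne_pos k l h0 hj)]
      simp only [subdivide_zero, subdivide_two]
      linear_combination this

omit [NeZero N] in
-- Two consecutive values are carried through the induction, as the recurrence has order two. With U
-- of index -1 and -2 equal to 0 and -1, the formulas hold from j = 0 on, so N = 1 needs no separate
-- treatment.
theorem eq_of_interior {S : ZMod (3 * N) → ℂ}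
    (h : ∀ k j, 0 < j → j < N → S (pos N k + (j : ℕ) + 1) + S (pos N k + (j : ℕ) - 1)
        = 2 * x * S (pos N k + (j : ℕ))) (k : Fin 3) (j : ℕ) (hj : j < N) :
    S (pos N k + j) = evalU x (j - 1) * S (pos N k + 1) - evalU x (j - 2) * S (pos N k) ∧
    S (pos N k + j + 1) = evalU x j * S (pos N k + 1) - evalU x (j - 1) * S (pos N k) := by
  induction j with
  | zero => simp
  | succ j ih =>
    obtain ⟨h1, h2⟩ := ih (by omega)
    have h3 := h k (j + 1) (by omega) hj
    have e : pos N k + ((j + 1 : ℕ) : ZMod (3 * N)) = pos N k + j + 1 := by push_cast; ring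
    have e2 : pos N k + (j : ZMod (3 * N)) + 1 - 1 = pos N k + j := by ring
    rw [e, e2] at h3
    rw [e]
    have e3 : (((j + 1 : ℕ) : ℤ) - 1) = j := by push_cast; ring
    have e4 : (((j + 1 : ℕ) : ℤ) - 2) = j - 1 := by push_cast; ring
    rw [e3, e4]
    refine ⟨h2, ?_⟩
    have u1 := evalU_add_two x (j - 1)
    have u2 := evalU_add_two x (j - 2)
    rw [show (j : ℤ) - 1 + 2 = (j + 1 : ℕ) by push_cast; ring,
      show (j : ℤ) - 1 + 1 = j by ring] at u1
    rw [show (j : ℤ) - 2 + 2 = j by ring, show (j : ℤ) - 2 + 1 = j - 1 by ring] at u2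
    linear_combination h3 - h1 + 2 * x * h2 - S (pos N k + 1) * u1 + S (pos N k) * u2

/-- An eigenfunction is transported along each arc from the values at a corner subcell and at the
next one. What remains is matching at the far end of the arc and the equation at the corner
subcells, which are the two conditions of `cornerData`. -/
theorem finrank_cellEigen_subdivide :
    Module.finrank ℂ (cellEigen (subdivide N σ) (2 * x + 1)) =
      Module.finrank ℂ (cornerData N σ x) := by
  have hN : 0 < N := NeZero.pos N
  have hcast : ((N - 1 : ℕ) : ℤ) = N - 1 := by push_cast [hN]; ring
  have hpred : ∀ k : Fin 3, pos N k + ((N - 1 : ℕ) : ZMod (3 * N)) = pos N (k + 1) - 1 := by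
    intro k
    rw [pos_add_one]
    push_cast [hN]
    ring
  apply finrank_eq_of_bijOn _ _
    ((LinearMap.funLeft ℂ ℂ fun a : W × Fin 3 => (a.1, pos N a.2)).prod
      (LinearMap.funLeft ℂ ℂ fun a : W × Fin 3 => (a.1, pos N a.2 + 1)))
  · intro S hS
    obtain ⟨h1, h2⟩ := mem_cellEigen_subdivide.1 hS
    refine mem_cornerData.2 fun c k => ?_
    simp only [LinearMap.funLeft_apply]
    obtain ⟨h3, h4⟩ := eq_of_interior (S := fun i => S (c, i)) (h1 c) k (N - 1) (by omega)
    rw [hpred, hcast] at h3 h4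
    rw [sub_add_cancel] at h4
    rw [← h2 c (k + 1)]
    rw [show (N : ℤ) - 1 - 1 = N - 2 by ring, show (N : ℤ) - 1 - 2 = N - 3 by ring] at h3
    rw [show (N : ℤ) - 1 - 1 = N - 2 by ring] at h4
    exact ⟨h4, by rw [h3]⟩
  · intro S hS h0
    obtain ⟨h1, h2⟩ := mem_cellEigen_subdivide.1 hS
    have hs : ∀ c k, S (c, pos N k) = 0 := fun c k => congrFun (congrArg Prod.fst h0) (c, k)
    have hd : ∀ c k, S (c, pos N k + 1) = 0 := fun c k => congrFun (congrArg Prod.snd h0) (c, k)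
    ext ⟨c, i⟩
    obtain ⟨k, j, hj, rfl⟩ := exists_eq_pos_add i
    have := (eq_of_interior (S := fun i => S (c, i)) (h1 c) k j hj).1
    simpa [hs, hd] using this
  · rintro ⟨s, d⟩ hsd
    rw [mem_cornerData] at hsd
    -- The three arcs fit together: at j = N the formula gives s at the next corner by the first
    -- condition of `cornerData`.
    choose S hS using fun c => exists_ring_function (N := N)
      (fun k (j : ℕ) => evalU x (j - 1) * d (c, k) - evalU x (j - 2) * s (c, k))
      (fun k => by simpa using (hsd c k).1.symm)
    have hS' : ∀ c k, S c (pos N k) = s (c, k) := fun c k => by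
      simpa using hS c k 0 (Nat.zero_le _)
    have hS1 : ∀ c k, S c (pos N k + 1) = d (c, k) := fun c k => by
      have := hS c k 1 hN
      norm_num at this
      exact this
    refine ⟨fun a => S a.1 a.2, mem_cellEigen_subdivide.2 ⟨fun c k j h0 hj => ?_, fun c k => ?_⟩, ?_⟩
    · have e1 : pos N k + (j : ZMod (3 * N)) + 1 = pos N k + ((j + 1 : ℕ) : ZMod (3 * N)) := by
        push_cast; ring
      have e2 : pos N k + (j : ZMod (3 * N)) - 1 = pos N k + ((j - 1 : ℕ) : ZMod (3 * N)) := by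
        push_cast [h0]; ring
      simp only
      rw [e1, e2, hS c k _ hj, hS c k j hj.le, hS c k (j - 1) (by omega)]
      have u1 := evalU_add_two x (j - 2)
      have u2 := evalU_add_two x (j - 3)
      rw [show (j : ℤ) - 2 + 2 = j by ring, show (j : ℤ) - 2 + 1 = j - 1 by ring] at u1
      rw [show (j : ℤ) - 3 + 2 = j - 1 by ring, show (j : ℤ) - 3 + 1 = j - 2 by ring] at u2
      rw [show ((j - 1 : ℕ) : ℤ) = j - 1 by push_cast [h0]; ring,
        show ((j + 1 : ℕ) : ℤ) = j + 1 by push_cast; ring,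
        show (j : ℤ) + 1 - 1 = j by ring, show (j : ℤ) + 1 - 2 = j - 1 by ring,
        show (j : ℤ) - 1 - 1 = j - 2 by ring, show (j : ℤ) - 1 - 2 = j - 3 by ring]
      linear_combination d (c, k) * u1 - s (c, k) * u2
    · obtain ⟨l, rfl⟩ : ∃ l, k = l + 1 := ⟨k - 1, (sub_add_cancel k 1).symm⟩
      have h3 := hS c l (N - 1) (by omega)
      rw [hpred, hcast, show (N : ℤ) - 1 - 1 = N - 2 by ring,
        show (N : ℤ) - 1 - 2 = N - 3 by ring] at h3
      simp only [hS', hS1, h3]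
      exact (hsd c l).2
    · ext ⟨c, k⟩
      · exact hS' c k
      · exact hS1 c k

end

/-! ### Elimination down to the corner values, then to the cells of the level below. -/

section

theorem chebT_cos (N : ℕ) (θ : ℂ) : chebT N (Complex.cos θ) = Complex.cos (N * θ) := by
  exact_mod_cast Chebyshev.T_complex_cos θ (N : ℤ)

theorem chebU_cos_mul_sin (N : ℕ) (θ : ℂ) :
    chebU N (Complex.cos θ) * Complex.sin θ = Complex.sin (N * θ) := by
  have := Chebyshev.U_complex_cos θ ((N : ℤ) - 1)
  push_cast at this
  rwa [sub_add_cancel] at this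

theorem pell (N : ℕ) (x : ℂ) : chebT N x ^ 2 - (x ^ 2 - 1) * chebU N x ^ 2 = 1 := by
  obtain ⟨θ, rfl⟩ := Complex.cos_surjective x
  have h1 := chebU_cos_mul_sin N θ
  have h2 := Complex.sin_sq_add_cos_sq θ
  have h3 := Complex.sin_sq_add_cos_sq (N * θ)
  rw [chebT_cos]
  linear_combination (-(chebU N (Complex.cos θ)) ^ 2) * h2 + h3 + (chebU N (Complex.cos θ) * Complex.sin θ + Complex.sin (N * θ)) * h1

theorem evalU_sub_one (N : ℕ) (x : ℂ) : evalU x (N - 1) = chebU N x := rfl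

theorem evalU_sub_two (N : ℕ) (x : ℂ) :
    evalU x (N - 2) = x * chebU N x - chebT N x := by
  have := congrArg (eval x) (Chebyshev.T_eq_X_mul_U_sub_U ℂ ((N : ℤ) - 2))
  simp only [eval_sub, eval_mul, eval_X, sub_add_cancel] at this
  rw [show (N : ℤ) - 2 + 1 = N - 1 by ring] at this
  rw [evalU, chebU, chebT, this]
  ring

theorem evalU_sub_three (N : ℕ) (x : ℂ) :
    evalU x (N - 3) = 2 * x * (x * chebU N x - chebT N x) - chebU N x := by
  have := evalU_add_two x (N - 3)
  rw [show (N : ℤ) - 3 + 2 = N - 1 by ring, show (N : ℤ) - 3 + 1 = N - 2 by ring, evalU_sub_one,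
    evalU_sub_two] at this
  linear_combination this

variable {N : ℕ} {W : Type}

theorem sum_fin_three_rotate (f : Fin 3 → ℂ) (k : Fin 3) :
    ∑ l, f l = f k + f (k + 1) + f (k + 1 + 1) := by
  rw [Fin.sum_univ_three]
  fin_cases k
  · rfl
  · change _ = f 1 + f 2 + f 0
    ring
  · change _ = f 2 + f 0 + f 1
    ring

/-- The functions `s` on corners with `t s = ∑ s + u s ∘ σ`, the sum being over the corners of a
cell. -/
def cornerEigen (σ : W × Fin 3 → W × Fin 3) (t u : ℂ) : Submodule ℂ (W × Fin 3 → ℂ) where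
  carrier := {s | ∀ c k, t * s (c, k) = ∑ l, s (c, l) + u * s (σ (c, k))}
  zero_mem' := by simp
  add_mem' hf hg c k := by
    simp only [Pi.add_apply, mul_add, Finset.sum_add_distrib]
    linear_combination hf c k + hg c k
  smul_mem' r f hf c k := by
    simp only [Pi.smul_apply, smul_eq_mul, ← Finset.mul_sum]
    linear_combination r * hf c k

theorem mem_cornerEigen {σ : W × Fin 3 → W × Fin 3} {t u : ℂ} {s : W × Fin 3 → ℂ} :
    s ∈ cornerEigen σ t u ↔ ∀ c k, t * s (c, k) = ∑ l, s (c, l) + u * s (σ (c, k)) := Iff.rfl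

variable {σ : W × Fin 3 → W × Fin 3} {x : ℂ}

/-- The first condition gives d in terms of s, because U ≠ 0. Substituting into U times the second
condition, Pell's identity turns the coefficient of the preceding corner value into 1, so the three
corners of the cell enter symmetrically. -/
theorem finrank_cornerData (hU : chebU N x ≠ 0) :
    Module.finrank ℂ (cornerData N σ x) =
      Module.finrank ℂ (cornerEigen σ (2 * chebT N x + 1 + chebU N x) (chebU N x)) := by
  have hp := pell N x
  apply finrank_eq_of_bijOn _ _ (LinearMap.fst ℂ _ _)
  · rintro ⟨s, d⟩ h
    simp only [mem_cornerData, evalU_sub_one, evalU_sub_two, evalU_sub_three] at h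
    refine mem_cornerEigen.2 fun c k' => ?_
    obtain ⟨k, rfl⟩ : ∃ k, k' = k + 1 := ⟨k' - 1, (sub_add_cancel k' 1).symm⟩
    obtain ⟨h1, h2⟩ := h c k
    obtain ⟨h3, -⟩ := h c (k + 1)
    simp only [LinearMap.fst_apply]
    rw [sum_fin_three_rotate (fun l => s (c, l)) k]
    linear_combination chebU N x * h2 - h3 - (x * chebU N x - chebT N x) * h1
      + s (c, k) * hp
  · rintro ⟨s, d⟩ h h0
    simp only [mem_cornerData, evalU_sub_one, evalU_sub_two, evalU_sub_three] at h
    simp only [LinearMap.fst_apply] at h0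
    subst h0
    ext ⟨c, k⟩
    · rfl
    · have := (h c k).1
      simpa [hU] using this
  · intro s hs
    rw [mem_cornerEigen] at hs
    refine ⟨(s, fun a => (s (a.1, a.2 + 1) + (x * chebU N x - chebT N x) * s a) / chebU N x),
      ?_, rfl⟩
    simp only [mem_cornerData, evalU_sub_one, evalU_sub_two, evalU_sub_three]
    intro c k
    have h1 := hs c (k + 1)
    rw [sum_fin_three_rotate (fun l => s (c, l)) k] at h1
    constructor
    · field_simp
      ring
    · field_simp
      linear_combination h1 - s (c, k) * hp

/-- Adding and subtracting the equations at a corner and at its glued partner expresses s through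
the cell sums, with denominators 2T + 1 and 2T + 2U + 1. Summing over a cell gives the equation for
the sums. -/
theorem finrank_cornerEigen_generic (hσ : IsGluing σ) {T U lam : ℂ} (hU : U ≠ 0)
    (hT : 2 * T + 1 ≠ 0) (hA : 2 * T + 2 * U + 1 ≠ 0)
    (hlam : U * lam = 3 * U - 2 * (1 - T) * (2 * T + 2 * U + 1)) :
    Module.finrank ℂ (cornerEigen σ (2 * T + 1 + U) U) =
      Module.finrank ℂ (cellEigen σ lam) := by
  have key : ∀ s ∈ cornerEigen σ (2 * T + 1 + U) U, ∀ c k,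
      2 * (2 * T + 1) * (2 * T + 2 * U + 1) * s (c, k) =
        (2 * T + 2 * U + 1) * (∑ l, s (c, l) + ∑ l, s ((σ (c, k)).1, l)) +
        (2 * T + 1) * (∑ l, s (c, l) - ∑ l, s ((σ (c, k)).1, l)) := by
    intro s hs c k
    have h1 := hs c k
    have h2 := hs (σ (c, k)).1 (σ (c, k)).2
    rw [Prod.mk.eta, hσ.involutive] at h2
    linear_combination (2 * (2 * T + 1 + U)) * h1 + 2 * U * h2
  apply finrank_eq_of_bijOn _ _ (cornerSum W)
  · intro s hs
    refine mem_cellEigen.2 fun c => ?_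
    simp only [cornerSum_apply]
    have h1 : ∑ k, 2 * (2 * T + 1) * (2 * T + 2 * U + 1) * s (c, k) = _ :=
      Finset.sum_congr rfl fun k _ => key s hs c k
    simp only [mul_add, mul_sub, Finset.sum_add_distrib, Finset.sum_sub_distrib,
      ← Finset.mul_sum, Finset.sum_const, Finset.card_univ, Fintype.card_fin, nsmul_eq_mul] at h1
    push_cast at h1
    apply mul_left_cancel₀ hU
    linear_combination -h1 / 2 - (∑ k, s (c, k)) * hlam
  · intro s hs h0
    ext ⟨c, k⟩
    have h1 := key s hs c k
    have h2 : ∀ d, ∑ l, s (d, l) = 0 := fun d => congrFun h0 d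
    rw [h2, h2] at h1
    have : 2 * (2 * T + 1) * (2 * T + 2 * U + 1) ≠ 0 :=
      mul_ne_zero (mul_ne_zero two_ne_zero hT) hA
    simpa [this] using h1
  · intro p hp
    rw [mem_cellEigen] at hp
    have hD : 2 * (2 * T + 1) * (2 * T + 2 * U + 1) ≠ 0 :=
      mul_ne_zero (mul_ne_zero two_ne_zero hT) hA
    -- Half the sum of the even part (p + p')/(2T + 1) and the odd part (p - p')/(2T + 2U + 1), over
    -- a common denominator.
    have hs : cornerSum W (fun a => ((2 * T + 2 * U + 1) * (p a.1 + p (σ a).1) +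
      (2 * T + 1) * (p a.1 - p (σ a).1)) / (2 * (2 * T + 1) * (2 * T + 2 * U + 1))) = p := by
      ext c
      have h1 := hp c
      rw [cornerSum_apply, ← Finset.sum_div, div_eq_iff hD]
      simp only [mul_add, mul_sub, Finset.sum_add_distrib,
        Finset.sum_sub_distrib, ← Finset.mul_sum, h1, Finset.sum_const, Finset.card_univ,
        Fintype.card_fin, nsmul_eq_mul]
      push_cast
      linear_combination (2 * p c) * hlam
    refine ⟨_, mem_cornerEigen.2 fun c k => ?_, hs⟩
    have h2 := congrFun hs c
    rw [cornerSum_apply] at h2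
    rw [h2, hσ.involutive, mul_div_assoc', mul_div_assoc', div_eq_iff hD, add_mul (p c),
      div_mul_cancel₀ _ hD]
    ring

/-- The case 2T + 1 = 0. The even part of the equation makes the cell sums alternate, so they
vanish, and what is left is s = s∘σ. -/
theorem cornerEigen_eq_even_null (hσ : IsGluing σ) (hc : IsConnected σ) (hb : HasBoundary σ)
    {U : ℂ} (hU : U ≠ 0) : cornerEigen σ U U = signedNull σ 1 := by
  ext s
  rw [mem_cornerEigen, mem_signedNull]
  constructor
  · intro h
    have h0 : (fun c => ∑ l, s (c, l)) = 0 := by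
      refine hc.eq_zero_of_alternating hb fun c k => ?_
      have h1 := h c k
      have h2 := h (σ (c, k)).1 (σ (c, k)).2
      rw [Prod.mk.eta, hσ.involutive] at h2
      linear_combination -h1 - h2
    refine ⟨?_, fun c => congrFun h0 c⟩
    rintro ⟨c, k⟩
    have h1 := h c k
    rw [show ∑ l, s (c, l) = 0 from congrFun h0 c, zero_add] at h1
    rw [one_mul, mul_left_cancel₀ hU h1]
  · rintro ⟨h1, h2⟩ c k
    rw [h2, h1]
    ring

/-- The odd part of the equation makes the cell sums equal on neighbouring cells, hence constant.
Summing the equation over all corners multiplies this constant by 2(T - 1) and the number of cells,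
so it vanishes; what is left is s∘σ = -s. -/
theorem cornerEigen_eq_odd_null [Fintype W] (hσ : IsGluing σ) (hc : IsConnected σ)
    {T U : ℂ} (hU : U ≠ 0) (hA : 2 * T + 2 * U + 1 = 0) (hT : T ≠ 1) :
    cornerEigen σ (2 * T + 1 + U) U = signedNull σ (-1) := by
  ext s
  rw [mem_cornerEigen, mem_signedNull]
  constructor
  · intro h
    have e : Function.Bijective σ := Function.Involutive.bijective hσ.involutive
    have h0 : ∀ c k, ∑ l, s ((σ (c, k)).1, l) = ∑ l, s (c, l) := by
      intro c k
      have h1 := h c k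
      have h2 := h (σ (c, k)).1 (σ (c, k)).2
      rw [Prod.mk.eta, hσ.involutive] at h2
      linear_combination h1 - h2 + (s (σ (c, k)) - s (c, k)) * hA
    have h1 := hc (fun c => ∑ l, s (c, l)) h0
    have h2 : ∀ c, ∑ l, s (c, l) = 0 := by
      intro c
      have h3 : ∑ a : W × Fin 3, (2 * T + 1 + U) * s a =
          ∑ a : W × Fin 3, (∑ l, s (a.1, l) + U * s (σ a)) :=
        Finset.sum_congr rfl fun a _ => h a.1 a.2
      rw [Finset.sum_add_distrib, ← Finset.mul_sum, ← Finset.mul_sum,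
        e.sum_comp (fun a => s a)] at h3
      have h4 : ∑ a : W × Fin 3, ∑ l, s (a.1, l) = 3 * ∑ a : W × Fin 3, s a := by
        rw [Fintype.sum_prod_type, Fintype.sum_prod_type]
        simp [Finset.mul_sum]
      have h5 : ∑ a : W × Fin 3, s a = Fintype.card W * ∑ l, s (c, l) := by
        rw [Fintype.sum_prod_type, Finset.sum_congr rfl fun d _ => h1 d c]
        simp
      rw [h4, h5] at h3
      have h6 : (Fintype.card W : ℂ) ≠ 0 := by
        have : Nonempty W := ⟨c⟩
        exact_mod_cast Fintype.card_ne_zero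
      have h7 : (2 * (T - 1) * Fintype.card W) * ∑ l, s (c, l) = 0 := by linear_combination h3
      have h8 : 2 * (T - 1) * Fintype.card W ≠ 0 :=
        mul_ne_zero (mul_ne_zero two_ne_zero (sub_ne_zero.2 hT)) h6
      exact (mul_eq_zero.1 h7).resolve_left h8
    refine ⟨?_, h2⟩
    rintro ⟨c, k⟩
    have h3 := h c k
    rw [h2] at h3
    apply mul_left_cancel₀ hU
    linear_combination -h3 + s (c, k) * hA
  · rintro ⟨h1, h2⟩ c k
    rw [h2, h1]
    linear_combination s (c, k) * hA

/-- The corner values change sign from each corner to the next, and three sign changes around the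
ring force them to be zero. Then the same applies to d. -/
theorem cornerData_eq_bot (hU : chebU N x = 0) (hT : chebT N x = -1) :
    cornerData N σ x = ⊥ := by
  rw [Submodule.eq_bot_iff]
  rintro ⟨s, d⟩ h
  simp only [mem_cornerData, evalU_sub_one, evalU_sub_two, evalU_sub_three, hU, hT] at h
  have cyc : ∀ f : Fin 3 → ℂ, (∀ k, f (k + 1) = -f k) → ∀ k, f k = 0 := by
    intro f hf k
    have h1 := hf k
    have h2 := hf (k + 1)
    have h3 := hf (k + 1 + 1)
    rw [show k + 1 + 1 + 1 = k by fin_cases k <;> rfl] at h3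
    linear_combination (h1 - h2 + h3) / 2
  have hs : ∀ c k, s (c, k) = 0 := fun c =>
    cyc (fun k => s (c, k)) fun k => by linear_combination (h c k).1
  have hd : ∀ c k, d (c, k) = 0 := fun c => cyc (fun k => d (c, k)) fun k => by
    have := (h c k).2
    have h0 : s (σ (c, k + 1)) = 0 := hs _ _
    rw [hs, hs, h0] at this
    linear_combination -this
  ext ⟨c, k⟩
  · exact hs c k
  · exact hd c k

/-- The values s are constant on each cell, and the second condition telescopes around the ring, so
they form a harmonic function on cells, constant by `hσ`. Then d is constant on each cell and
otherwise free: the parameters are one number per cell and the value of s. -/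
theorem finrank_cornerData_degenerate [Fintype W] [Nonempty W]
    (hσ : ∀ q : W → ℂ, (∀ c, ∑ k, q (σ (c, k)).1 = 3 * q c) → ∀ c d, q c = q d)
    (hU : chebU N x = 0) (hT : chebT N x = 1) :
    Module.finrank ℂ (cornerData N σ x) = Fintype.card W + 1 := by
  obtain ⟨c₀⟩ := ‹Nonempty W›
  have hfin : Module.finrank ℂ ((W → ℂ) × ℂ) = Fintype.card W + 1 := by
    rw [Module.finrank_prod, Module.finrank_fintype_fun_eq_card, Module.finrank_self]
  rw [← hfin]
  have key : ∀ s d, (s, d) ∈ cornerData N σ x →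
      (∀ a b, s a = s b) ∧ ∀ c k, d (c, k) = d (c, 0) := by
    intro s d h
    simp only [mem_cornerData, evalU_sub_one, evalU_sub_two, evalU_sub_three, hU, hT] at h
    have all : ∀ f : Fin 3 → ℂ, (∀ k, f (k + 1) = f k) → ∀ k, f k = f 0 := by
      intro f hf k
      have h1 := hf 0
      have h2 := hf 1
      rcases fin_three_cases k with rfl | rfl | rfl
      · rfl
      · exact h1
      · exact h2.trans h1
    have hs : ∀ c k, s (c, k) = s (c, 0) := fun c =>
      all (fun k => s (c, k)) fun k => by linear_combination (h c k).1
    have hs' : ∀ a, s a = s (a.1, 0) := fun a => hs a.1 a.2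
    have hd : ∀ c k, d (c, k) - d (c, k + 1) = s ((σ (c, k + 1)).1, 0) - s (c, 0) := by
      intro c k
      have := (h c k).2
      rw [hs' (c, k + 1), hs' (c, k), hs' (σ (c, k + 1))] at this
      linear_combination this
    have hsum : ∀ c, ∑ k, s ((σ (c, k)).1, 0) = 3 * s (c, 0) := by
      intro c
      have h0 := hd c 0
      have h1 := hd c 1
      have h2 := hd c 2
      rw [show (2 : Fin 3) + 1 = 0 from rfl] at h2
      rw [show (1 : Fin 3) + 1 = 2 from rfl] at h1
      rw [show (0 : Fin 3) + 1 = 1 from rfl] at h0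
      rw [Fin.sum_univ_three]
      linear_combination -h0 - h1 - h2
    have hq := hσ (fun c => s (c, 0)) hsum
    refine ⟨fun a b => by rw [hs', hs' b]; exact hq a.1 b.1, fun c => all (fun k => d (c, k)) ?_⟩
    intro k
    linear_combination -hq (σ (c, k + 1)).1 c - hd c k
  refine finrank_eq_of_bijOn_top _ (((LinearMap.funLeft ℂ ℂ fun c : W => (c, (0 : Fin 3))) ∘ₗ
    LinearMap.snd ℂ _ _).prod ((LinearMap.proj (c₀, 0)) ∘ₗ LinearMap.fst ℂ _ _)) ?_ ?_
  · rintro ⟨s, d⟩ h h0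
    obtain ⟨h1, h2⟩ := key s d h
    ext ⟨c, k⟩
    · exact (h1 _ (c₀, 0)).trans (congrArg Prod.snd h0)
    · exact (h2 c k).trans (congrFun (congrArg Prod.fst h0) c)
  · rintro ⟨e, q⟩
    refine ⟨(fun _ => q, fun a => e a.1), ?_, rfl⟩
    simp only [mem_cornerData, evalU_sub_one, evalU_sub_two, evalU_sub_three, hU, hT]
    exact fun c k => ⟨by ring, by ring⟩

end

/-! ### The cells of the gasket -/

/-- The words of length `n`, which index the cells of level `n`; the last letter is split off. -/
def Cell (N : ℕ) : ℕ → Type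
  | 0 => Unit
  | n + 1 => Cell N n × ZMod (3 * N)

noncomputable instance instFintypeCell (N : ℕ) [NeZero N] : ∀ n, Fintype (Cell N n)
  | 0 => inferInstanceAs (Fintype Unit)
  | n + 1 =>
    have := instFintypeCell N n
    inferInstanceAs (Fintype (Cell N n × ZMod (3 * N)))

instance instNonemptyCell (N : ℕ) : ∀ n, Nonempty (Cell N n)
  | 0 => inferInstanceAs (Nonempty Unit)
  | n + 1 =>
    have := instNonemptyCell N n
    inferInstanceAs (Nonempty (Cell N n × ZMod (3 * N)))

theorem card_cell (N : ℕ) [NeZero N] (n : ℕ) : Fintype.card (Cell N n) = (3 * N) ^ n := by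
  induction n with
  | zero => rfl
  | succ n ih =>
    have : Fintype.card (Cell N (n + 1)) = Fintype.card (Cell N n × ZMod (3 * N)) := by
      rw [← Nat.card_eq_fintype_card, ← Nat.card_eq_fintype_card]
      rfl
    rw [this, Fintype.card_prod, ih, ZMod.card, pow_succ]

/-- The gluing of the cells of level `n`. -/
noncomputable def glue (N : ℕ) : ∀ n, Cell N n × Fin 3 → Cell N n × Fin 3
  | 0 => id
  | n + 1 => subdivide N (glue N n)

section

variable (N : ℕ) [NeZero N]

theorem isGluing_glue (n : ℕ) : IsGluing (glue N n) := by
  induction n with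
  | zero =>
    exact ⟨fun _ => rfl, fun _ _ _ h => congrArg Prod.snd h, fun _ _ _ _ _ => rfl⟩
  | succ n ih => exact ih.subdivide

theorem isConnected_glue (n : ℕ) : IsConnected (glue N n) := by
  induction n with
  | zero => exact fun p _ _ _ => rfl
  | succ n ih => exact ih.subdivide

theorem hasBoundary_glue (n : ℕ) : HasBoundary (glue N n) := by
  induction n with
  | zero => exact ⟨((), 0), rfl⟩
  | succ n ih => exact ih.subdivide

end

/-! ### The number of vertices -/

open Classical in
/-- The inverse of the number of corners at the vertex of a corner. -/
noncomputable def cornerWeight {W : Type} (σ : W × Fin 3 → W × Fin 3) (a : W × Fin 3) : ℚ :=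
  if σ a = a then 1 else 1 / 2

/-- The number of orbits of the gluing on corners. -/
noncomputable def weight {W : Type} [Fintype W] (σ : W × Fin 3 → W × Fin 3) : ℚ :=
  ∑ a, cornerWeight σ a

section

variable {W X : Type} {σ : W × Fin 3 → W × Fin 3}

theorem cornerWeight_of_eq {a : W × Fin 3} (h : σ a = a) : cornerWeight σ a = 1 := if_pos h

theorem cornerWeight_of_ne {a : W × Fin 3} (h : σ a ≠ a) : cornerWeight σ a = 1 / 2 := if_neg h

/-- In each ring, corners 0 and 2 are always glued and contribute 3N in all. The 3N - 3 corners 1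
away from the original corners are unglued, and the other three inherit their status. -/
theorem weight_subdivide [Fintype W] {N : ℕ} [NeZero N] :
    weight (subdivide N σ) = weight σ + (6 * N - 3) * Fintype.card W := by
  have h : ∀ c, ∑ i : ZMod (3 * N), ∑ k, cornerWeight (subdivide N σ) ((c, i), k) =
      (6 * N - 3) + ∑ k, cornerWeight σ (c, k) := by
    intro c
    have h1 : ∀ i : ZMod (3 * N), ∑ k, cornerWeight (subdivide N σ) ((c, i), k) =
        cornerWeight (subdivide N σ) ((c, i), 1) + 1 := by
      intro i
      rw [Fin.sum_univ_three, cornerWeight_of_ne (a := ((c, i), 0)),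
        cornerWeight_of_ne (a := ((c, i), 2))]
      · ring
      · simp [Prod.ext_iff]
      · simp [Prod.ext_iff]
    simp only [h1]
    rw [Finset.sum_add_distrib, sum_ring_eq]
    · have h2 : ∀ k, cornerWeight (subdivide N σ) ((c, pos N k), 1) = cornerWeight σ (c, k) := by
        intro k
        have : (subdivide N σ ((c, pos N k), 1) = ((c, pos N k), 1)) ↔ σ (c, k) = (c, k) := by
          rw [subdivide_pos, Prod.ext_iff, Prod.ext_iff, Prod.ext_iff]
          simp [pos_injective.eq_iff]
        by_cases hk : σ (c, k) = (c, k)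
        · rw [cornerWeight_of_eq hk, cornerWeight_of_eq (this.2 hk)]
        · rw [cornerWeight_of_ne hk, cornerWeight_of_ne (this.not.2 hk)]
      simp only [h2, Finset.sum_const, Finset.card_univ, ZMod.card, nsmul_eq_mul]
      push_cast
      ring
    · intro i hi
      exact cornerWeight_of_eq (subdivide_of_ne σ c hi)
  rw [weight, weight, Fintype.sum_prod_type, Fintype.sum_prod_type]
  simp only [Fintype.sum_prod_type, h]
  rw [Finset.sum_add_distrib]
  simp only [Finset.sum_const, Finset.card_univ, nsmul_eq_mul]
  ring

theorem card_eq_weight [Fintype W] [Fintype X] (hσ : IsGluing σ) (π : W × Fin 3 → X)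
    (hπ : Function.Surjective π) (h : ∀ a b, π a = π b ↔ b = a ∨ b = σ a) :
    (Fintype.card X : ℚ) = weight σ := by
  classical
  rw [weight, ← Finset.sum_fiberwise Finset.univ π]
  have : ∀ x, ∑ a with π a = x, cornerWeight σ a = 1 := by
    intro x
    obtain ⟨a, rfl⟩ := hπ x
    have hf : (Finset.univ.filter fun b => π b = π a) = {a, σ a} := by
      ext b
      rw [Finset.mem_filter, eq_comm, h]
      simp
    rw [hf]
    by_cases ha : σ a = a
    · simp [ha, cornerWeight_of_eq]
    · rw [Finset.sum_pair (Ne.symm ha), cornerWeight_of_ne ha, cornerWeight_of_ne]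
      · norm_num
      · rw [hσ.involutive]
        exact Ne.symm ha
  simp only [this, Finset.sum_const, Finset.card_univ, nsmul_eq_mul, mul_one]

theorem finrank_even [Fintype X] (π : W × Fin 3 → X)
    (hπ : Function.Surjective π) (h : ∀ a b, π a = π b ↔ b = a ∨ b = σ a) :
    Module.finrank ℂ (signed σ 1) = Fintype.card X := by
  rw [← Module.finrank_fintype_fun_eq_card ℂ, ← finrank_top ℂ (X → ℂ), eq_comm]
  apply finrank_eq_of_bijOn _ _ (LinearMap.funLeft ℂ ℂ π)
  · intro f _ a
    rw [LinearMap.funLeft_apply, LinearMap.funLeft_apply, one_mul, (h a (σ a)).2 (Or.inr rfl)]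
  · intro f _ h0
    ext x
    obtain ⟨a, rfl⟩ := hπ x
    exact congrFun h0 a
  · intro g hg
    choose r hr using hπ
    refine ⟨fun x => g (r x), trivial, ?_⟩
    ext a
    rw [LinearMap.funLeft_apply]
    rcases (h a (r (π a))).1 (hr (π a)).symm with h1 | h1
    · rw [h1]
    · rw [h1, hg, one_mul]

end

theorem weight_glue (N : ℕ) [NeZero N] (n : ℕ) :
    weight (glue N n) = (3 * N + (6 * N - 3) * (3 * N) ^ n) / (3 * N - 1) := by
  have hN : (3 * N - 1 : ℚ) ≠ 0 := by
    have : (1 : ℚ) ≤ N := by exact_mod_cast NeZero.one_le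
    linarith
  induction n with
  | zero =>
    have : weight (glue N 0) = 3 := by
      have : ∀ a, cornerWeight (glue N 0) a = 1 := fun a => cornerWeight_of_eq rfl
      simp [weight, this, card_cell]
    rw [this, eq_div_iff hN]
    ring
  | succ n ih =>
    rw [show weight (glue N (n + 1)) = weight (subdivide N (glue N n)) from rfl,
      weight_subdivide, ih, card_cell]
    push_cast
    field_simp
    ring

/-! ### The points of the gasket -/

section

variable {N : ℕ}

theorem pos_one : pos N 1 = (N : ZMod (3 * N)) := by simp [pos]

theorem pos_zero : pos N 0 = ((3 * N : ℕ) : ZMod (3 * N)) := by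
  rw [ZMod.natCast_self]
  simp [pos]

/-- The word of the `k`-th corner of the gasket. -/
def cornerWord (N : ℕ) (k : Fin 3) : Words N := prepend (pos N k) (constN N)

theorem prepend_constN : prepend (N : ZMod (3 * N)) (constN N) = constN N := by
  ext k
  cases k <;> rfl

theorem cornerWord_one : cornerWord N 1 = constN N := by
  rw [cornerWord, pos_one, prepend_constN]

@[simp] theorem foldr_prepend_length_add (w : List (ZMod (3 * N))) (u : Words N) (k : ℕ) :
    w.foldr prepend u (w.length + k) = u k := by
  induction w with
  | nil => simp
  | cons i w ih =>
    rw [List.foldr_cons, List.length_cons, Nat.add_right_comm]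
    exact ih

theorem foldr_prepend_of_lt (w : List (ZMod (3 * N))) (u u' : Words N) (k : ℕ)
    (hk : k < w.length) : w.foldr prepend u k = w.foldr prepend u' k := by
  induction w generalizing k with
  | nil => simp at hk
  | cons i w ih =>
    cases k with
    | zero => rfl
    | succ k => exact ih k (by simpa using hk)

theorem eq_foldr_prepend {w : List (ZMod (3 * N))} {s u : Words N}
    (h1 : ∀ k < w.length, s k = w.foldr prepend u k) (h2 : ∀ k, s (w.length + k) = u k) :
    s = w.foldr prepend u := by
  ext k
  rcases lt_or_ge k w.length with hk | hk
  · exact h1 k hk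
  · obtain ⟨k, rfl⟩ := Nat.exists_eq_add_of_le hk
    rw [h2, foldr_prepend_length_add]

theorem exists_prefix (s : Words N) (m : ℕ) : ∃ w : List (ZMod (3 * N)), w.length = m ∧
    ∀ u, ∀ k < m, s k = w.foldr prepend u k := by
  induction m generalizing s with
  | zero => exact ⟨[], rfl, by simp⟩
  | succ m ih =>
    obtain ⟨w, hw, h⟩ := ih fun k => s (k + 1)
    refine ⟨s 0 :: w, by simp [hw], fun u k hk => ?_⟩
    cases k with
    | zero => rfl
    | succ k => exact h u k (by omega)

/-- Two words are identified by the gluing at position `m`. -/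
structure GlueAt (m : ℕ) (s t : Words N) : Prop where
  prefix_eq : ∀ k < m, s k = t k
  left : s m = t m + 1
  left_succ : s (m + 1) = pos N 2
  right_succ : t (m + 1) = pos N 0
  left_tail : ∀ k, m + 2 ≤ k → s k = pos N 1
  right_tail : ∀ k, m + 2 ≤ k → t k = pos N 1

theorem glue_iff {s t : Words N} : Glue N s t ↔ ∃ m, GlueAt m s t := by
  constructor
  · rintro ⟨w, i, j, h⟩
    refine ⟨w.length, fun k hk => foldr_prepend_of_lt _ _ _ _ hk, ?_, ?_, ?_, ?_, ?_⟩
    · have h1 := foldr_prepend_length_add w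
        (prepend i (prepend ((2 * N : ℕ) : ZMod (3 * N)) (constN N))) 0
      have h2 := foldr_prepend_length_add w
        (prepend j (prepend ((3 * N : ℕ) : ZMod (3 * N)) (constN N))) 0
      exact h1.trans (h.trans (congrArg (· + 1) h2.symm))
    · exact foldr_prepend_length_add _ _ 1
    · exact (foldr_prepend_length_add _ _ 1).trans pos_zero.symm
    all_goals
      intro k hk
      obtain ⟨k, rfl⟩ := Nat.exists_eq_add_of_le hk
      rw [add_assoc, pos_one, foldr_prepend_length_add, add_comm]
      rfl
  · rintro ⟨m, h⟩
    obtain ⟨w, hw, hs⟩ := exists_prefix s m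
    have e1 : s = w.foldr prepend
        (prepend (s m) (prepend ((2 * N : ℕ) : ZMod (3 * N)) (constN N))) := by
      refine eq_foldr_prepend (fun k hk => hs _ k (hw ▸ hk)) fun k => ?_
      rw [hw]
      match k with
      | 0 => rfl
      | 1 => exact h.left_succ
      | k + 2 => exact (h.left_tail _ (by omega)).trans pos_one
    have e2 : t = w.foldr prepend
        (prepend (t m) (prepend ((3 * N : ℕ) : ZMod (3 * N)) (constN N))) := by
      refine eq_foldr_prepend (fun k hk => (h.prefix_eq k (hw ▸ hk)).symm.trans
        (hs _ k (hw ▸ hk))) fun k => ?_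
      rw [hw]
      match k with
      | 0 => rfl
      | 1 => exact h.right_succ.trans pos_zero
      | k + 2 => exact (h.right_tail _ (by omega)).trans pos_one
    rw [e1, e2]
    exact Glue.glue w _ _ h.left

variable [NeZero N]

omit [NeZero N] in
-- A glued word determines the position m: its letter at m + 1 is the last one different from N.
theorem last_unique {s : Words N} {m n : ℕ} (h1 : s (m + 1) ≠ pos N 1)
    (h2 : ∀ k, m + 2 ≤ k → s k = pos N 1) (h3 : s (n + 1) ≠ pos N 1)
    (h4 : ∀ k, n + 2 ≤ k → s k = pos N 1) : m = n := by
  by_contra hne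
  rcases Nat.lt_or_gt_of_ne hne with h | h
  · exact h3 (h2 _ (by omega))
  · exact h1 (h4 _ (by omega))

theorem pos_ne {k l : Fin 3} (h : k ≠ l) : pos N k ≠ pos N l := pos_injective.ne h

theorem GlueAt.left_ne {m : ℕ} {s t : Words N} (h : GlueAt m s t) : s (m + 1) ≠ pos N 1 := by
  rw [h.left_succ]
  exact pos_ne (by decide)

theorem GlueAt.right_ne {m : ℕ} {s t : Words N} (h : GlueAt m s t) : t (m + 1) ≠ pos N 1 := by
  rw [h.right_succ]
  exact pos_ne (by decide)

theorem not_glue_trans {s t u : Words N} (h1 : Glue N s t) (h2 : Glue N t u) : False := by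
  obtain ⟨m, h1⟩ := glue_iff.1 h1
  obtain ⟨n, h2⟩ := glue_iff.1 h2
  obtain rfl := last_unique h1.right_ne h1.right_tail h2.left_ne h2.left_tail
  exact pos_ne (by decide) (h1.right_succ.symm.trans h2.left_succ)

theorem glue_right_unique {s t u : Words N} (h1 : Glue N s t) (h2 : Glue N s u) : t = u := by
  obtain ⟨m, h1⟩ := glue_iff.1 h1
  obtain ⟨n, h2⟩ := glue_iff.1 h2
  obtain rfl := last_unique h1.left_ne h1.left_tail h2.left_ne h2.left_tail
  ext k
  rcases lt_trichotomy k m with hk | rfl | hk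
  · exact (h1.prefix_eq k hk).symm.trans (h2.prefix_eq k hk)
  · exact add_right_cancel (h1.left.symm.trans h2.left)
  · rcases Nat.eq_or_lt_of_le hk with rfl | hk
    · exact h1.right_succ.trans h2.right_succ.symm
    · exact (h1.right_tail k hk).trans (h2.right_tail k hk).symm

theorem glue_left_unique {s t u : Words N} (h1 : Glue N s u) (h2 : Glue N t u) : s = t := by
  obtain ⟨m, h1⟩ := glue_iff.1 h1
  obtain ⟨n, h2⟩ := glue_iff.1 h2
  obtain rfl := last_unique h1.right_ne h1.right_tail h2.right_ne h2.right_tail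
  ext k
  rcases lt_trichotomy k m with hk | rfl | hk
  · exact (h1.prefix_eq k hk).trans (h2.prefix_eq k hk).symm
  · exact h1.left.trans h2.left.symm
  · rcases Nat.eq_or_lt_of_le hk with rfl | hk
    · exact h1.left_succ.trans h2.left_succ.symm
    · exact (h1.left_tail k hk).trans (h2.left_tail k hk).symm

/-- The point of the gasket represented by a word. -/
def ofWord (s : Words N) : Gasket N := Quot.mk _ s

/-- The generated equivalence relation has classes of at most two words. No word is on the left of
one identification and on the right of another (its last letter different from N would be both 2N
and 3N), and partners are unique. -/
theorem ofWord_eq_iff {s t : Words N} :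
    ofWord s = ofWord t ↔ s = t ∨ Glue N s t ∨ Glue N t s := by
  constructor
  · intro h
    have key : ∀ {x y}, Relation.EqvGen (Glue N) x y → x = y ∨ Glue N x y ∨ Glue N y x := by
      intro x y h
      induction h with
      | rel _ _ h => exact Or.inr (Or.inl h)
      | refl _ => exact Or.inl rfl
      | symm x y h ih =>
        rcases ih with h | h | h
        exacts [Or.inl h.symm, Or.inr (Or.inr h), Or.inr (Or.inl h)]
      | trans x y z h1 h2 ih1 ih2 =>
        rcases ih1 with rfl | h1 | h1
        · exact ih2
        · rcases ih2 with rfl | h2 | h2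
          · exact Or.inr (Or.inl h1)
          · exact (not_glue_trans h1 h2).elim
          · exact Or.inl (glue_left_unique h1 h2)
        · rcases ih2 with rfl | h2 | h2
          · exact Or.inr (Or.inr h1)
          · exact Or.inl (glue_right_unique h1 h2)
          · exact (not_glue_trans h2 h1).elim
    exact key (Quot.eqvGen_exact h)
  · rintro (rfl | h | h)
    exacts [rfl, Quot.sound h, (Quot.sound h).symm]

/-! ### The corners of the cells -/

omit [NeZero N] in
theorem ofWord_foldr_prepend (w : List (ZMod (3 * N))) (s : Words N) :
    ofWord (w.foldr prepend s) = Fw N w (ofWord s) := by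
  induction w with
  | nil => rfl
  | cons i w ih => exact congrArg (F N i) ih

/-- The letters of a cell. -/
def Cell.letters : ∀ n, Cell N n → List (ZMod (3 * N))
  | 0, _ => []
  | n + 1, c => Cell.letters n c.1 ++ [c.2]

omit [NeZero N] in
theorem Cell.length_letters (n : ℕ) (c : Cell N n) : (Cell.letters n c).length = n := by
  induction n with
  | zero => rfl
  | succ n ih => rw [Cell.letters, List.length_append, ih]; rfl

omit [NeZero N] in
theorem Cell.letters_surjective (n : ℕ) (w : List (ZMod (3 * N))) (hw : w.length = n) :
    ∃ c, Cell.letters n c = w := by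
  induction n generalizing w with
  | zero => exact ⟨(), (List.length_eq_zero_iff.1 hw).symm⟩
  | succ n ih =>
    rcases List.eq_nil_or_concat w with rfl | ⟨w, i, rfl⟩
    · simp at hw
    · obtain ⟨c, rfl⟩ := ih w (by simpa using hw)
      exact ⟨(c, i), by simp [Cell.letters]⟩

omit [NeZero N] in
theorem Cell.letters_injective (n : ℕ) : Function.Injective (Cell.letters (N := N) n) := by
  induction n with
  | zero => exact fun _ _ _ => rfl
  | succ n ih =>
    rintro ⟨c, i⟩ ⟨d, j⟩ h
    obtain ⟨h1, h2⟩ := List.append_inj' h rfl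
    exact Prod.ext (ih h1) (List.singleton_injective h2)

/-- The word of a corner of a cell. -/
def address (n : ℕ) (a : Cell N n × Fin 3) : Words N :=
  (Cell.letters n a.1).foldr prepend (cornerWord N a.2)

/-- The corner of a cell, as a point of the gasket. -/
def point (n : ℕ) (a : Cell N n × Fin 3) : Gasket N := ofWord (address n a)

omit [NeZero N] in
theorem address_succ (n : ℕ) (c : Cell N n) (i : ZMod (3 * N)) (k : Fin 3) :
    address (n + 1) ((c, i), k) = (Cell.letters n c).foldr prepend (prepend i (cornerWord N k)) := by
  simp [address, Cell.letters]

omit [NeZero N] in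
-- A corner of a cell is corner 1 of the subcell there, with the very same word, because corner 1 is
-- represented by NNN….
theorem address_pos (n : ℕ) (c : Cell N n) (k : Fin 3) :
    address (n + 1) ((c, pos N k), 1) = address n (c, k) := by
  rw [address_succ, cornerWord_one]
  rfl

omit [NeZero N] in
theorem address_add (n : ℕ) (a : Cell N n × Fin 3) (k : ℕ) :
    address n a (n + k) = cornerWord N a.2 k := by
  have := foldr_prepend_length_add (Cell.letters n a.1) (cornerWord N a.2) k
  rwa [Cell.length_letters] at this

omit [NeZero N] in
theorem address_self (n : ℕ) (a : Cell N n × Fin 3) : address n a n = pos N a.2 :=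
  address_add n a 0

omit [NeZero N] in
theorem address_of_lt (n : ℕ) (a : Cell N n × Fin 3) {k : ℕ} (hk : n < k) :
    address n a k = pos N 1 := by
  obtain ⟨k, rfl⟩ := Nat.exists_eq_add_of_lt hk
  rw [add_assoc, address_add, pos_one]
  rfl

omit [NeZero N] in
theorem address_succ_self (n : ℕ) (c : Cell N n) (i : ZMod (3 * N)) (k : Fin 3) :
    address (n + 1) ((c, i), k) n = i := by
  rw [address_succ]
  have := foldr_prepend_length_add (Cell.letters n c) (prepend i (cornerWord N k)) 0
  rwa [Cell.length_letters] at this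

omit [NeZero N] in
theorem foldr_prepend_inj {v w : List (ZMod (3 * N))} (s t : Words N) (hl : v.length = w.length)
    (h : ∀ k < v.length, v.foldr prepend s k = w.foldr prepend t k) : v = w := by
  induction v generalizing w with
  | nil => exact (List.length_eq_zero_iff.1 hl.symm).symm
  | cons i v ih =>
    cases w with
    | nil => simp at hl
    | cons j w =>
      have h0 := h 0 (by simp)
      rw [ih (w := w) (by simpa using hl) fun k hk => h (k + 1) (by simpa using hk)]
      exact congrArg (· :: w) h0

omit [NeZero N] in
theorem cell_eq_of_address {n : ℕ} {a b : Cell N n × Fin 3}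
    (h : ∀ k < n, address n a k = address n b k) : a.1 = b.1 := by
  apply Cell.letters_injective
  refine foldr_prepend_inj _ _ ?_ fun k hk => h k ?_
  · rw [Cell.length_letters, Cell.length_letters]
  · rwa [Cell.length_letters] at hk

theorem address_injective (n : ℕ) : Function.Injective (address (N := N) n) := by
  intro a b h
  refine Prod.ext (cell_eq_of_address fun k _ => by rw [h]) ?_
  apply pos_injective (N := N)
  rw [← address_self n a, ← address_self n b, h]

theorem point_glue (n : ℕ) (a : Cell N n × Fin 3) : point n (glue N n a) = point n a := by
  induction n with
  | zero => rfl
  | succ n ih =>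
    have h02 : ∀ (c : Cell N n) (i : ZMod (3 * N)), point (n + 1) ((c, i + 1), 2) = point (n + 1) ((c, i), 0) := by
      intro c i
      apply Quot.sound
      rw [address_succ, address_succ, cornerWord, cornerWord, pos_zero]
      exact Glue.glue _ _ _ rfl
    have h1 : ∀ (c : Cell N n) (k : Fin 3),
        point (n + 1) ((c, pos N k), 1) = point n (c, k) := fun c k =>
      congrArg ofWord (address_pos n c k)
    obtain ⟨⟨c, i⟩, k⟩ := a
    rcases fin_three_cases k with rfl | rfl | rfl
    · exact h02 c i
    · by_cases hi : ∃ k, pos N k = i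
      · obtain ⟨k, rfl⟩ := hi
        exact (congrArg (point (n + 1)) (subdivide_pos (glue N n) c k)).trans
          ((h1 _ _).trans ((ih (c, k)).trans (h1 c k).symm))
      · push Not at hi
        exact congrArg (point (n + 1)) (subdivide_of_ne (glue N n) c hi)
    · have := h02 c (i - 1)
      rw [sub_add_cancel] at this
      exact this.symm

/-- If m is the position of the last letter of the cell, the gluing joins consecutive subcells of
one ring at corners 2 and 0. If m is smaller, both corners are of index 1 at corners of the coarser
cells, which reduces to the previous level. A larger m is impossible, since all later letters are N.
-/
theorem glue_of_glueAt (n m : ℕ) (a b : Cell N n × Fin 3)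
    (h : GlueAt m (address n a) (address n b)) : b = glue N n a := by
  induction n with
  | zero => exact (h.left_ne (address_of_lt 0 a (by omega))).elim
  | succ n ih =>
    obtain ⟨⟨c, i⟩, k⟩ := a
    obtain ⟨⟨d, j⟩, l⟩ := b
    change _ = subdivide N (glue N n) ((c, i), k)
    rcases lt_trichotomy m n with hm | rfl | hm
    · have hk : k = 1 := pos_injective ((address_self (n + 1) ((c, i), k)).symm.trans
        (h.left_tail _ (by omega)))
      have hl : l = 1 := pos_injective ((address_self (n + 1) ((d, j), l)).symm.trans
        (h.right_tail _ (by omega)))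
      subst hk hl
      obtain ⟨k, rfl⟩ : ∃ k, i = pos N k := by
        rw [← address_succ_self n c i 1]
        rcases Nat.eq_or_lt_of_le hm with rfl | hm
        exacts [⟨_, h.left_succ⟩, ⟨_, h.left_tail _ hm⟩]
      obtain ⟨l, rfl⟩ : ∃ l, j = pos N l := by
        rw [← address_succ_self n d j 1]
        rcases Nat.eq_or_lt_of_le hm with rfl | hm
        exacts [⟨_, h.right_succ⟩, ⟨_, h.right_tail _ hm⟩]
      rw [address_pos, address_pos] at h
      rw [subdivide_pos, ← ih _ _ h]
      rfl
    · have hk : k = 2 := pos_injective ((address_self (m + 1) ((c, i), k)).symm.trans h.left_succ)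
      have hl : l = 0 := pos_injective ((address_self (m + 1) ((d, j), l)).symm.trans h.right_succ)
      have hij := h.left
      rw [address_succ_self, address_succ_self] at hij
      subst hk hl hij
      rw [subdivide_two, add_sub_cancel_right]
      have : c = d := by
        apply Cell.letters_injective
        have hp := h.prefix_eq
        rw [address_succ, address_succ] at hp
        refine foldr_prepend_inj _ _ ?_ fun k hk => hp k ?_
        · rw [Cell.length_letters, Cell.length_letters]
        · rwa [Cell.length_letters] at hk
      rw [this]
      rfl
    · exact (h.left_ne (address_of_lt (n + 1) _ (by omega))).elim

theorem point_eq_iff (n : ℕ) (a b : Cell N n × Fin 3) :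
    point n a = point n b ↔ b = a ∨ b = glue N n a := by
  constructor
  · intro h
    rcases ofWord_eq_iff.1 h with h | h | h
    · exact Or.inl (address_injective n h).symm
    · obtain ⟨m, h⟩ := glue_iff.1 h
      exact Or.inr (glue_of_glueAt n m a b h)
    · obtain ⟨m, h⟩ := glue_iff.1 h
      rw [glue_of_glueAt n m b a h, (isGluing_glue N n).involutive]
      exact Or.inr rfl
  · rintro (rfl | rfl)
    exacts [rfl, (point_glue n a).symm]

omit [NeZero N] in
theorem V_zero : V N 0 = Set.range fun k => ofWord (cornerWord N k) := by
  have h1 : v₁ N = ofWord (cornerWord N 1) := by rw [cornerWord_one]; rfl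
  have h2 : v₂ N = ofWord (cornerWord N 2) := rfl
  have h3 : v₃ N = ofWord (cornerWord N 0) := by rw [cornerWord, pos_zero]; rfl
  ext x
  rw [V, h1, h2, h3, Set.mem_range]
  constructor
  · rintro (rfl | rfl | rfl)
    exacts [⟨1, rfl⟩, ⟨2, rfl⟩, ⟨0, rfl⟩]
  · rintro ⟨k, rfl⟩
    rcases fin_three_cases k with rfl | rfl | rfl
    exacts [Or.inr (Or.inr rfl), Or.inl rfl, Or.inr (Or.inl rfl)]

omit [NeZero N] in
theorem mem_Fw_image (n : ℕ) (c : Cell N n) (x : Gasket N) :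
    x ∈ Fw N (Cell.letters n c) '' V N 0 ↔ ∃ k, x = point n (c, k) := by
  rw [V_zero]
  simp only [Set.mem_image, Set.mem_range, exists_exists_eq_and, ← ofWord_foldr_prepend]
  exact exists_congr fun k => eq_comm

omit [NeZero N] in
theorem mem_V_iff_word (n : ℕ) (x : Gasket N) :
    x ∈ V N n ↔ ∃ w : List (ZMod (3 * N)), w.length = n ∧ x ∈ Fw N w '' V N 0 := by
  induction n generalizing x with
  | zero =>
    constructor
    · exact fun h => ⟨[], rfl, x, h, rfl⟩
    · rintro ⟨w, hw, y, hy, rfl⟩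
      rw [List.length_eq_zero_iff.1 hw]
      exact hy
  | succ n ih =>
    simp only [V, Set.mem_iUnion, Set.mem_image (F N _), ih]
    constructor
    · rintro ⟨i, _, ⟨w, hw, y, hy, rfl⟩, rfl⟩
      exact ⟨i :: w, by simp [hw], y, hy, rfl⟩
    · rintro ⟨w, hw, y, hy, rfl⟩
      cases w with
      | nil => simp at hw
      | cons i w => exact ⟨i, _, ⟨w, by simpa using hw, y, hy, rfl⟩, rfl⟩

omit [NeZero N] in
theorem mem_V_iff (n : ℕ) (x : Gasket N) : x ∈ V N n ↔ ∃ a, x = point n a := by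
  rw [mem_V_iff_word]
  constructor
  · rintro ⟨w, hw, hx⟩
    obtain ⟨c, rfl⟩ := Cell.letters_surjective n w hw
    obtain ⟨k, hk⟩ := (mem_Fw_image n c x).1 hx
    exact ⟨_, hk⟩
  · rintro ⟨⟨c, k⟩, hk⟩
    exact ⟨_, Cell.length_letters n c, (mem_Fw_image n c x).2 ⟨k, hk⟩⟩

/-- The vertex of the graph of level `n` at a corner. -/
def vertex (n : ℕ) (a : Cell N n × Fin 3) : V N n := ⟨point n a, (mem_V_iff n _).2 ⟨a, rfl⟩⟩

omit [NeZero N] in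
theorem vertex_surjective (n : ℕ) : Function.Surjective (vertex (N := N) n) := by
  rintro ⟨x, hx⟩
  obtain ⟨a, rfl⟩ := (mem_V_iff n x).1 hx
  exact ⟨a, rfl⟩

theorem vertex_eq_iff (n : ℕ) (a b : Cell N n × Fin 3) :
    vertex n a = vertex n b ↔ b = a ∨ b = glue N n a := by
  rw [← point_eq_iff, vertex, vertex, Subtype.mk.injEq]

omit [NeZero N] in
theorem graph_adj_iff (n : ℕ) (x y : V N n) :
    (graph N n).Adj x y ↔ x ≠ y ∧ ∃ c k l, x = vertex n (c, k) ∧ y = vertex n (c, l) := by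
  refine and_congr_right fun _ => ?_
  constructor
  · rintro ⟨w, hw, hx, hy⟩
    obtain ⟨c, rfl⟩ := Cell.letters_surjective n w hw
    obtain ⟨k, hk⟩ := (mem_Fw_image n c _).1 hx
    obtain ⟨l, hl⟩ := (mem_Fw_image n c _).1 hy
    exact ⟨c, k, l, Subtype.ext hk, Subtype.ext hl⟩
  · rintro ⟨c, k, l, rfl, rfl⟩
    exact ⟨_, Cell.length_letters n c, (mem_Fw_image n c _).2 ⟨k, rfl⟩,
      (mem_Fw_image n c _).2 ⟨l, rfl⟩⟩

theorem card_V (n : ℕ) :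
    (Fintype.card (V N n) : ℚ) = (3 * N + (6 * N - 3) * (3 * N) ^ n) / (3 * N - 1) := by
  rw [card_eq_weight (isGluing_glue N n) (vertex n) (vertex_surjective n) (vertex_eq_iff n),
    weight_glue]

theorem finrank_signed_glue (n : ℕ) :
    Module.finrank ℂ (signed (glue N n) 1) = Fintype.card (V N n) :=
  finrank_even (vertex n) (vertex_surjective n) (vertex_eq_iff n)

end

/-! ### The Laplacian in terms of cells -/

section

variable {N : ℕ} [NeZero N]

open Classical in
theorem complexLaplacian_apply (n : ℕ) (f : V N n → ℂ) (x : V N n) :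
    complexLaplacian N n f x =
      f x - 1 / ((graph N n).degree x : ℂ) * ∑ y ∈ (graph N n).neighborFinset x, f y := by
  have h : ∀ y, laplacianMatrix N n x y = (if x = y then 1 else 0) -
      1 / ((graph N n).degree x : ℝ) * (if y ∈ (graph N n).neighborFinset x then 1 else 0) := by
    intro y
    rw [laplacianMatrix, LinearMap.toMatrix'_apply]
    simp [laplacian, Pi.single_apply]
  rw [complexLaplacian, Matrix.toLin'_apply, Matrix.mulVec, dotProduct]
  simp only [Matrix.map_apply, h]
  have h2 : ∀ y, (algebraMap ℝ ℂ) ((if x = y then 1 else 0) -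
      1 / ((graph N n).degree x : ℝ) * (if y ∈ (graph N n).neighborFinset x then 1 else 0)) * f y
      = (if x = y then f y else 0) - 1 / ((graph N n).degree x : ℂ) *
        (if y ∈ (graph N n).neighborFinset x then f y else 0) := by
    intro y
    split_ifs <;> simp only [map_sub, map_mul, map_one, map_zero, map_div₀, map_natCast] <;> ring
  simp only [h2]
  rw [Finset.sum_sub_distrib, ← Finset.mul_sum, Finset.sum_ite_mem, Finset.univ_inter,
    Finset.sum_ite_eq, if_pos (Finset.mem_univ x)]

/-- The pairs of a corner at `x` and another corner of the same cell. -/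
def cornerPairs (n : ℕ) (x : V N n) : Set ((Cell N n × Fin 3) × Fin 3) :=
  {b | vertex n b.1 = x ∧ b.2 ≠ b.1.2}

/-- Two cells share at most one vertex, so no neighbour is reached twice. Hence degrees are twice
the number of cells at a vertex. -/
theorem injOn_cornerPairs (n : ℕ) (x : V N n) :
    Set.InjOn (fun b : (Cell N n × Fin 3) × Fin 3 => vertex n (b.1.1, b.2))
      (cornerPairs n x) := by
  have hσ := isGluing_glue N n
  rintro ⟨⟨c, k⟩, l⟩ ⟨h1, h2⟩ ⟨⟨c', k'⟩, l'⟩ ⟨h3, h4⟩ h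
  simp only at h1 h2 h3 h4 h
  rcases (vertex_eq_iff n (c, k) (c', k')).1 (h1.trans h3.symm) with h5 | h5
  · obtain ⟨rfl, rfl⟩ := Prod.mk.inj h5
    rcases (vertex_eq_iff n _ _).1 h with h6 | h6
    · rw [(Prod.mk.inj h6).2]
    · rw [hσ.eq_of_same _ _ _ h6.symm]
  · have hc : c' = c → k' = k := by
      rintro rfl
      exact (hσ.eq_of_same _ _ _ h5.symm).symm
    have hc' : c' = c → (((c, k), l) : (Cell N n × Fin 3) × Fin 3) = ((c', k'), l') := by
      intro e
      have e' := hc e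
      subst e e'
      rcases (vertex_eq_iff n _ _).1 h with h6 | h6
      · rw [(Prod.mk.inj h6).2]
      · rw [hσ.eq_of_same _ _ _ h6.symm]
    apply hc'
    rcases (vertex_eq_iff n _ _).1 h with h6 | h6
    · exact congrArg Prod.fst h6
    · have := hσ.eq_of_two c k l (by rw [← h5, ← h6]) (Ne.symm h2)
      rwa [← h5] at this

open Classical in
theorem neighborFinset_eq (n : ℕ) (x : V N n) :
    (graph N n).neighborFinset x = (cornerPairs n x).toFinset.image
      fun b : (Cell N n × Fin 3) × Fin 3 => vertex n (b.1.1, b.2) := by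
  have hσ := isGluing_glue N n
  ext y
  rw [SimpleGraph.mem_neighborFinset, graph_adj_iff, Finset.mem_image]
  simp only [Set.mem_toFinset]
  constructor
  · rintro ⟨hne, c, k, l, rfl, rfl⟩
    refine ⟨((c, k), l), ⟨rfl, ?_⟩, rfl⟩
    rintro (rfl : l = k)
    exact hne rfl
  · rintro ⟨⟨⟨c, k⟩, l⟩, ⟨rfl, h2⟩, rfl⟩
    refine ⟨fun h => ?_, c, k, l, rfl, rfl⟩
    rcases (vertex_eq_iff n _ _).1 h with h6 | h6
    · exact h2 (congrArg Prod.snd h6)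
    · exact h2 (hσ.eq_of_same _ _ _ h6.symm).symm

open Classical in
theorem sum_neighborFinset (n : ℕ) (x : V N n) (f : V N n → ℂ) :
    ∑ y ∈ (graph N n).neighborFinset x, f y =
      ∑ b with vertex n b = x, (∑ l, f (vertex n (b.1, l)) - f x) := by
  have hs : (cornerPairs n x).toFinset =
      ((Finset.univ.filter fun b => vertex n b = x).sigma
        fun b => Finset.univ.erase b.2).map (Equiv.sigmaEquivProd _ _).toEmbedding := by
    ext b
    rw [Set.mem_toFinset]
    simp [cornerPairs]
  rw [neighborFinset_eq, Finset.sum_image (by simpa using injOn_cornerPairs n x), hs,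
    Finset.sum_map, Finset.sum_sigma]
  refine Finset.sum_congr rfl fun b hb => ?_
  have hb' : vertex n b = x := (Finset.mem_filter.1 hb).2
  have := Finset.add_sum_erase Finset.univ (fun l => f (vertex n (b.1, l))) (Finset.mem_univ b.2)
  simp only [Prod.mk.eta, hb'] at this
  rw [← this]
  simp

/-- An interior vertex has degree 4. A boundary vertex has degree 2 and `glue N n a = a`, so its
cell is counted twice and the denominator 4 still fits. -/
theorem complexLaplacian_vertex (n : ℕ) (f : V N n → ℂ) (a : Cell N n × Fin 3) :
    complexLaplacian N n f (vertex n a) = f (vertex n a) -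
      (∑ l, f (vertex n (a.1, l)) + ∑ l, f (vertex n ((glue N n a).1, l))
        - 2 * f (vertex n a)) / 4 := by
  classical
  have hσ := isGluing_glue N n
  -- The neighbour sum of the function 1: each corner at the vertex contributes 3 - 1 = 2.
  have hdeg : ((graph N n).degree (vertex n a) : ℂ) =
      ∑ b with vertex n b = vertex n a, (2 : ℂ) := by
    have := sum_neighborFinset n (vertex n a) 1
    simp only [Pi.one_apply, Finset.sum_const, Finset.card_univ, Fintype.card_fin,
      nsmul_eq_mul, mul_one] at this
    rw [SimpleGraph.degree]
    refine Eq.trans (by congr!) (this.trans ?_)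
    rw [Finset.sum_const, nsmul_eq_mul]
    norm_num
  have hf : (Finset.univ.filter fun b => vertex n b = vertex n a) = {a, glue N n a} := by
    ext b
    rw [Finset.mem_filter, eq_comm, vertex_eq_iff]
    simp
  rw [complexLaplacian_apply]
  have hs := sum_neighborFinset n (vertex n a) f
  have hsum : ∀ g : Cell N n × Fin 3 → ℂ, ∑ b with vertex n b = vertex n a, g b =
      ∑ b ∈ {a, glue N n a}, g b := fun g => Finset.sum_congr hf fun _ _ => rfl
  rw [hsum] at hs hdeg
  have key : 1 / ((graph N n).degree (vertex n a) : ℂ) *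
      ∑ y ∈ (graph N n).neighborFinset (vertex n a), f y =
      (∑ l, f (vertex n (a.1, l)) + ∑ l, f (vertex n ((glue N n a).1, l))
        - 2 * f (vertex n a)) / 4 := by
    rw [hdeg, hs]
    by_cases ha : glue N n a = a
    · rw [ha]
      simp only [Finset.pair_eq_singleton, Finset.sum_singleton]
      ring
    · rw [Finset.sum_pair (Ne.symm ha), Finset.sum_pair (Ne.symm ha)]
      ring
  rw [← key]

/-- The functions on vertices, as functions on corners, that are eigenfunctions of the Laplacian. -/
def vertexEigen {W : Type} (σ : W × Fin 3 → W × Fin 3) (z : ℂ) : Submodule ℂ (W × Fin 3 → ℂ) where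
  carrier := {h | (∀ a, h (σ a) = h a) ∧
    ∀ a, ∑ l, h (a.1, l) + ∑ l, h ((σ a).1, l) = 2 * (3 - 2 * z) * h a}
  zero_mem' := by simp
  add_mem' := by
    rintro f g ⟨f1, f2⟩ ⟨g1, g2⟩
    refine ⟨fun a => by simp [f1, g1], fun a => ?_⟩
    simp only [Pi.add_apply, Finset.sum_add_distrib]
    linear_combination f2 a + g2 a
  smul_mem' := by
    rintro r f ⟨f1, f2⟩
    refine ⟨fun a => by simp [f1], fun a => ?_⟩
    simp only [Pi.smul_apply, smul_eq_mul, ← Finset.mul_sum]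
    linear_combination r * f2 a

theorem mult_eq_finrank_vertexEigen (n : ℕ) (z : ℂ) :
    mult N n z = Module.finrank ℂ (vertexEigen (glue N n) z) := by
  have hσ := isGluing_glue N n
  apply finrank_eq_of_bijOn _ _ (LinearMap.funLeft ℂ ℂ (vertex n))
  · intro f hf
    rw [Module.End.mem_eigenspace_iff] at hf
    refine ⟨fun a => ?_, fun a => ?_⟩
    · rw [LinearMap.funLeft_apply, LinearMap.funLeft_apply,
        (vertex_eq_iff n a (glue N n a)).2 (Or.inr rfl)]
    · have := congrFun hf (vertex n a)
      rw [complexLaplacian_vertex, Pi.smul_apply, smul_eq_mul] at this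
      simp only [LinearMap.funLeft_apply]
      linear_combination -4 * this
  · intro f _ h0
    ext x
    obtain ⟨a, rfl⟩ := vertex_surjective n x
    exact congrFun h0 a
  · rintro g ⟨h1, h2⟩
    choose r hr using vertex_surjective (N := N) n
    have hg : ∀ a, g (r (vertex n a)) = g a := by
      intro a
      rcases (vertex_eq_iff n a _).1 (hr (vertex n a)).symm with h | h
      · rw [h]
      · rw [h, h1]
    refine ⟨fun x => g (r x), ?_, funext hg⟩
    rw [Module.End.mem_eigenspace_iff]
    ext x
    obtain ⟨a, rfl⟩ := vertex_surjective n x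
    rw [complexLaplacian_vertex, Pi.smul_apply, smul_eq_mul]
    simp only [hg]
    linear_combination -h2 a / 4

end

/-! ### From eigenfunctions on vertices to eigenfunctions on cells. -/

section

variable {W : Type} {σ : W × Fin 3 → W × Fin 3}

/-- The vertex values are the cell sums of the adjacent cells divided by 2(3 - 2z); adding this over
the corners of a cell gives the eigenvalue 3 - 4z. -/
theorem finrank_vertexEigen (hσ : IsGluing σ) {z : ℂ} (hz : z ≠ 3 / 2) :
    Module.finrank ℂ (vertexEigen σ z) = Module.finrank ℂ (cellEigen σ (3 - 4 * z)) := by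
  have hz' : 2 * (3 - 2 * z) ≠ 0 := by
    intro h
    apply hz
    linear_combination -h / 4
  apply finrank_eq_of_bijOn _ _ (cornerSum W)
  · rintro h ⟨-, h2⟩
    refine mem_cellEigen.2 fun c => ?_
    simp only [cornerSum_apply]
    have h3 := Finset.sum_congr rfl fun (k : Fin 3) (_ : k ∈ Finset.univ) => h2 (c, k)
    rw [Finset.sum_add_distrib, ← Finset.mul_sum] at h3
    simp only [Finset.sum_const, Finset.card_univ, Fintype.card_fin, nsmul_eq_mul] at h3
    push_cast at h3
    linear_combination h3
  · rintro h ⟨-, h2⟩ h0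
    ext a
    have h1 := h2 a
    have h3 : ∀ d, ∑ l, h (d, l) = 0 := fun d => congrFun h0 d
    rw [h3, h3] at h1
    simpa [hz'] using h1.symm
  · intro p hp
    rw [mem_cellEigen] at hp
    have hs : ∀ c, ∑ k, (p c + p (σ (c, k)).1) / (2 * (3 - 2 * z)) = p c := by
      intro c
      rw [← Finset.sum_div, div_eq_iff hz', Finset.sum_add_distrib, hp]
      simp only [Finset.sum_const, Finset.card_univ, Fintype.card_fin, nsmul_eq_mul]
      push_cast
      ring
    refine ⟨fun a => (p a.1 + p (σ a).1) / (2 * (3 - 2 * z)), ⟨fun a => ?_, fun a => ?_⟩, ?_⟩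
    · simp only [hσ.involutive, add_comm]
    · simp only [hs]
      rw [mul_div_cancel₀ _ hz']
    · ext c
      exact hs c

theorem vertexEigen_three_halves (hc : IsConnected σ) (hb : HasBoundary σ) :
    vertexEigen σ (3 / 2) = signedNull σ 1 := by
  ext h
  rw [mem_signedNull]
  constructor
  · rintro ⟨h1, h2⟩
    refine ⟨fun a => by rw [h1, one_mul], fun c => ?_⟩
    refine congrFun (hc.eq_zero_of_alternating hb (p := fun c => ∑ l, h (c, l)) fun c k => ?_) c
    linear_combination h2 (c, k)
  · rintro ⟨h1, h2⟩
    refine ⟨fun a => by rw [h1, one_mul], fun a => ?_⟩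
    rw [h2, h2]
    ring

end

/-! ### Chebyshev polynomials and the rational function -/

section

variable (N : ℕ) (x z : ℂ)

@[simp] theorem chebT_zero : chebT 0 x = 1 := by simp [chebT]

@[simp] theorem chebU_zero : chebU 0 x = 0 := by simp [chebU]

theorem chebU_succ : chebU (N + 1) x = x * chebU N x + chebT N x := by
  have h2 := congrArg (eval x) (Chebyshev.U_eq_X_mul_U_add_T ℂ ((N : ℤ) - 1))
  simp only [sub_add_cancel, eval_add, eval_mul, eval_X] at h2
  simpa [chebU, chebT] using h2

theorem chebT_succ : chebT (N + 1) x = x * chebT N x - (1 - x ^ 2) * chebU N x := by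
  have h2 := congrArg (eval x) (Chebyshev.T_eq_X_mul_T_sub_pol_U ℂ ((N : ℤ) - 1))
  rw [show (N : ℤ) - 1 + 2 = N + 1 by ring, sub_add_cancel] at h2
  simpa [chebU, chebT] using h2

theorem cheb_double (s : ℂ) : chebT N (2 * s ^ 2 - 1) = 2 * chebT N s ^ 2 - 1 ∧
    s * chebU N (2 * s ^ 2 - 1) = chebT N s * chebU N s := by
  induction N with
  | zero => simp; norm_num
  | succ N ih =>
    obtain ⟨h1, h2⟩ := ih
    have hp := pell N s
    rw [chebT_succ, chebU_succ, chebT_succ, chebU_succ, h1]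
    constructor
    · linear_combination (-4 * s * (1 - s ^ 2)) * h2 + (-2 * (1 - s ^ 2)) * hp
    · linear_combination (2 * s ^ 2 - 1) * h2 + s * hp

theorem cheb_neg : chebT N (-x) = (-1) ^ N * chebT N x ∧
    chebU N (-x) = -(-1) ^ N * chebU N x := by
  induction N with
  | zero => simp
  | succ N ih =>
    obtain ⟨h1, h2⟩ := ih
    rw [chebT_succ, chebU_succ, chebT_succ, chebU_succ, h1, h2]
    constructor <;> ring

theorem cheb_one : chebT N 1 = 1 ∧ chebU N 1 = N := by
  induction N with
  | zero => simp
  | succ N ih =>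
    obtain ⟨h1, h2⟩ := ih
    rw [chebT_succ, chebU_succ, h1, h2]
    constructor
    · ring
    · push_cast
      ring

/-! ### The square root and the functional equation of R. -/

theorem csqrt_sq : csqrt z ^ 2 = z := by
  rw [csqrt, one_div]
  exact Complex.cpow_ofNat_inv_pow z 2

theorem cheb_csqrt : chebT N (1 - 2 * z) = (-1) ^ N * (2 * chebT N (csqrt z) ^ 2 - 1) ∧
    csqrt z * chebU N (1 - 2 * z) = -(-1) ^ N * (chebT N (csqrt z) * chebU N (csqrt z)) := by
  obtain ⟨h1, h2⟩ := cheb_double N (csqrt z)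
  obtain ⟨h3, h4⟩ := cheb_neg N (2 * csqrt z ^ 2 - 1)
  rw [show -(2 * csqrt z ^ 2 - 1) = 1 - 2 * z by rw [csqrt_sq]; ring] at h3 h4
  rw [h3, h4, h1, ← h2]
  exact ⟨rfl, by ring⟩

/-- This form of R has no parity distinction and no square root. It comes from the doubling formulas
at √z, with Pell's identity rewriting 1 - T for even N. -/
theorem R_mul (h : denR N z ≠ 0) :
    2 * chebU N (1 - 2 * z) * R N z = (1 - chebT N (1 - 2 * z)) * polyA N z := by
  obtain ⟨h1, h2⟩ := cheb_csqrt N z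
  have hs := csqrt_sq z
  have hp := pell N (csqrt z)
  rw [R, mul_div_assoc', div_eq_iff h]
  by_cases hN : Even N
  · rw [hN.neg_one_pow] at h1 h2
    rw [numR, denR, if_pos hN, if_pos hN, h1]
    rw [hs] at hp
    linear_combination (2 * (z - 1) * chebU N (csqrt z) * polyA N z) * h2
      + (2 * chebT N (csqrt z) * polyA N z) * hp
  · have hN' := Nat.not_even_iff_odd.1 hN
    rw [hN'.neg_one_pow] at h1 h2
    rw [numR, denR, if_neg hN, if_neg hN, h1]
    linear_combination (2 * chebT N (csqrt z) * polyA N z) * h2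

theorem R_eq_zero_of_chebT (h : chebT N (1 - 2 * z) = 1) : R N z = 0 := by
  obtain ⟨h1, -⟩ := cheb_csqrt N z
  have hs := csqrt_sq z
  have hp := pell N (csqrt z)
  rw [R, div_eq_zero_iff]
  left
  rw [numR]
  by_cases hN : Even N
  · rw [hN.neg_one_pow, h] at h1
    rw [if_pos hN]
    rw [hs] at hp
    have h3 : ((z - 1) * chebU N (csqrt z)) * chebU N (csqrt z) = 0 := by
      linear_combination -hp - h1 / 2
    rcases mul_eq_zero.1 h3 with h3 | h3
    · linear_combination csqrt z * polyA N z * h3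
    · rw [h3]
      ring
  · rw [(Nat.not_even_iff_odd.1 hN).neg_one_pow, h] at h1
    have h3 : chebT N (csqrt z) ^ 2 = 0 := by linear_combination h1 / 2
    rw [if_neg hN, pow_eq_zero_iff two_ne_zero |>.1 h3]
    ring

theorem R_eq_zero_of_polyA (h : polyA N z = 0) : R N z = 0 := by
  rw [R, numR, h]
  simp

theorem chebU_ne_zero_of_chebT (h : 2 * chebT N x + 1 = 0) : chebU N x ≠ 0 := by
  intro hU
  have := pell N x
  rw [hU, show chebT N x = -1 / 2 by linear_combination h / 2] at this
  norm_num at this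

theorem R_eq_three_halves (h : 2 * chebT N (1 - 2 * z) + 1 = 0) (hd : denR N z ≠ 0) :
    R N z = 3 / 2 := by
  have h1 := R_mul N z hd
  apply mul_left_cancel₀ (mul_ne_zero two_ne_zero (chebU_ne_zero_of_chebT N _ h))
  rw [h1, polyA]
  linear_combination (1 - chebT N (1 - 2 * z) - chebU N (1 - 2 * z)) * h

theorem denR_ne_zero (hz : z ≠ 0) (hU : chebU N (1 - 2 * z) ≠ 0) : denR N z ≠ 0 := by
  obtain ⟨-, h2⟩ := cheb_csqrt N z
  have hs : csqrt z ≠ 0 := by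
    intro h
    apply hz
    rw [← csqrt_sq z, h]
    ring
  have h3 : csqrt z * chebU N (1 - 2 * z) ≠ 0 := mul_ne_zero hs hU
  rw [h2] at h3
  rw [denR]
  split_ifs
  · intro h
    simp [h] at h3
  · intro h
    simp [h] at h3

theorem chebT_sq_of_chebU (hU : chebU N x = 0) : chebT N x = 1 ∨ chebT N x = -1 := by
  have := pell N x
  rw [hU] at this
  exact mul_self_eq_one_iff.1 (by linear_combination this)

theorem three_add_two_mul_int_ne_zero (m : ℤ) : 3 + 2 * (m : ℂ) ≠ 0 := by
  intro h
  have : (3 + 2 * m : ℤ) = 0 := by exact_mod_cast h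
  omega

/-- If T = 1, Pell's identity gives U = 0 or z ∈ {0, 1}; in each case U is an integer, so 3 + 2U is
odd. -/
theorem polyA_ne_zero_of_chebT (h : chebT N (1 - 2 * z) = 1) : polyA N z ≠ 0 := by
  have hp := pell N (1 - 2 * z)
  rw [polyA]
  rw [h] at hp ⊢
  have h1 : z * (z - 1) * chebU N (1 - 2 * z) ^ 2 = 0 := by linear_combination -hp / 4
  have hint : ∃ m : ℤ, chebU N (1 - 2 * z) = m := by
    rcases mul_eq_zero.1 h1 with h1 | h1
    · rcases mul_eq_zero.1 h1 with rfl | h1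
      · exact ⟨N, by simp [cheb_one]⟩
      · rw [sub_eq_zero.1 h1, show (1 - 2 * 1 : ℂ) = -1 by norm_num, (cheb_neg N 1).2,
          (cheb_one N).2]
        exact ⟨-(-1) ^ N * N, by push_cast; ring⟩
    · exact ⟨0, by simpa using h1⟩
  obtain ⟨m, hm⟩ := hint
  rw [hm]
  have := three_add_two_mul_int_ne_zero m
  intro h
  apply this
  linear_combination h

theorem chebU_ne_zero_of_polyA (h : polyA N z = 0) : chebU N (1 - 2 * z) ≠ 0 := by
  intro hU
  rcases chebT_sq_of_chebU N _ hU with hT | hT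
  · exact polyA_ne_zero_of_chebT N z hT h
  · rw [polyA, hU, hT] at h
    norm_num at h

/-! ### The numbers `sin² (k π / (3 N))` -/

section

variable {N z}
variable [NeZero N]

omit [NeZero N] in
theorem one_sub_two_mul_sinSq (k : ℕ) :
    1 - 2 * sinSq N k = Complex.cos (((2 * (k * Real.pi / (3 * N)) : ℝ) : ℂ)) := by
  rw [sinSq, ← Complex.ofReal_cos, Real.cos_two_mul, Real.cos_sq']
  push_cast
  ring

theorem chebT_sinSq (k : ℕ) : chebT N (1 - 2 * sinSq N k) = (Real.cos (2 * k * Real.pi / 3) : ℝ) := by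
  have hN : (N : ℂ) ≠ 0 := Nat.cast_ne_zero.2 (NeZero.ne N)
  rw [one_sub_two_mul_sinSq, chebT_cos, Complex.ofReal_cos]
  congr 1
  push_cast
  field_simp

theorem chebU_sinSq (k : ℕ) : chebU N (1 - 2 * sinSq N k) *
    (Real.sin (2 * (k * Real.pi / (3 * N))) : ℝ) = (Real.sin (2 * k * Real.pi / 3) : ℝ) := by
  have hN : (N : ℂ) ≠ 0 := Nat.cast_ne_zero.2 (NeZero.ne N)
  rw [one_sub_two_mul_sinSq, Complex.ofReal_sin, chebU_cos_mul_sin, Complex.ofReal_sin]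
  congr 1
  push_cast
  field_simp

theorem chebT_sinSq_of_dvd {k : ℕ} (h : 3 ∣ k) : chebT N (1 - 2 * sinSq N k) = 1 := by
  obtain ⟨l, rfl⟩ := h
  rw [chebT_sinSq, show 2 * ((3 * l : ℕ) : ℝ) * Real.pi / 3 = l * (2 * Real.pi) by push_cast; ring,
    Real.cos_nat_mul_two_pi]
  simp

theorem chebT_sinSq_of_not_dvd {k : ℕ} (h : ¬ 3 ∣ k) :
    2 * chebT N (1 - 2 * sinSq N k) + 1 = 0 := by
  have h1 : Real.cos (2 * k * Real.pi / 3) ≠ 1 := by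
    intro h1
    obtain ⟨n, hn⟩ := (Real.cos_eq_one_iff _).1 h1
    have h2 : ((3 * n : ℤ) : ℝ) * (2 * Real.pi) = (k : ℤ) * (2 * Real.pi) := by
      push_cast
      linear_combination 3 * hn
    have h3 := mul_right_cancel₀ (by positivity) h2
    have h4 : 3 * n = k := by exact_mod_cast h3
    exact h (by exact_mod_cast Dvd.intro n h4)
  -- The triple angle formula gives 4c³ - 3c - 1 = (c - 1)(2c + 1)² = 0.
  have h2 := Real.cos_three_mul (2 * k * Real.pi / 3)
  rw [show 3 * (2 * k * Real.pi / 3) = k * (2 * Real.pi) by ring, Real.cos_nat_mul_two_pi] at h2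
  have h3 : (Real.cos (2 * k * Real.pi / 3) - 1) * (2 * Real.cos (2 * k * Real.pi / 3) + 1) ^ 2
      = 0 := by
    linear_combination -h2
  rcases mul_eq_zero.1 h3 with h3 | h3
  · exact absurd (sub_eq_zero.1 h3) h1
  · rw [chebT_sinSq]
    exact_mod_cast pow_eq_zero_iff two_ne_zero |>.1 h3

/-- In U sin θ = sin(Nθ) with θ = 2kπ/(3N) the right side is 0. Since 0 < θ < 2π, sin θ vanishes
only at θ = π, the excluded case 2k = 3N. -/
theorem chebU_sinSq_eq_zero {k : ℕ} (h : 3 ∣ k) (h1 : 1 ≤ k) (h2 : k ≤ 3 * N - 1)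
    (h3 : 2 * k ≠ 3 * N) : chebU N (1 - 2 * sinSq N k) = 0 := by
  have hU := chebU_sinSq (N := N) k
  have hr : Real.sin (2 * k * Real.pi / 3) = 0 := by
    obtain ⟨l, rfl⟩ := h
    rw [show 2 * ((3 * l : ℕ) : ℝ) * Real.pi / 3 = (2 * l : ℕ) * Real.pi by push_cast; ring,
      Real.sin_nat_mul_pi]
  rw [hr, Complex.ofReal_zero, mul_eq_zero] at hU
  refine hU.resolve_right fun h4 => ?_
  obtain ⟨n, hn⟩ := Real.sin_eq_zero_iff.1 (Complex.ofReal_eq_zero.1 h4)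
  have hN : (N : ℝ) ≠ 0 := Nat.cast_ne_zero.2 (NeZero.ne N)
  have h5 : ((n * (3 * N) : ℤ) : ℝ) * Real.pi = ((2 * k : ℤ) : ℝ) * Real.pi := by
    push_cast
    field_simp at hn
    linear_combination Real.pi * hn
  have h6 : n * (3 * N) = 2 * k := by exact_mod_cast mul_right_cancel₀ Real.pi_ne_zero h5
  have hpos : 0 < N := NeZero.pos N
  have h7 : 0 < n := by
    by_contra h7
    have : n * (3 * N) ≤ 0 := mul_nonpos_of_nonpos_of_nonneg (by omega) (by positivity)
    omega
  have h8 : n < 2 := by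
    by_contra h8
    have : 2 * (3 * (N : ℤ)) ≤ n * (3 * N) := by gcongr; omega
    omega
  obtain rfl : n = 1 := by omega
  omega

theorem sinSq_of_two_mul {k : ℕ} (h : 2 * k = 3 * N) : sinSq N k = 1 := by
  have hN : (N : ℝ) ≠ 0 := Nat.cast_ne_zero.2 (NeZero.ne N)
  have h1 : (2 * k : ℝ) = 3 * N := by exact_mod_cast h
  rw [sinSq, show (k : ℝ) * Real.pi / (3 * N) = Real.pi / 2 by
    field_simp; linear_combination h1, Real.sin_pi_div_two]
  simp

theorem chebU_neg_one_ne_zero : chebU N (1 - 2 * 1) ≠ 0 := by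
  rw [show (1 - 2 * 1 : ℂ) = -1 by norm_num, (cheb_neg N 1).2, (cheb_one N).2]
  have hN : (N : ℂ) ≠ 0 := Nat.cast_ne_zero.2 (NeZero.ne N)
  exact mul_ne_zero (neg_ne_zero.2 (pow_ne_zero _ (by norm_num))) hN

theorem sinSq_ne_zero {k : ℕ} (h1 : 1 ≤ k) (h2 : k ≤ 3 * N - 1) : sinSq N k ≠ 0 := by
  have hN : 0 < N := NeZero.pos N
  have hN' : (0 : ℝ) < N := by exact_mod_cast hN
  have hk : (0 : ℝ) < k := by exact_mod_cast h1
  have hk' : (k : ℝ) < 3 * N := by exact_mod_cast (by omega : k < 3 * N)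
  rw [sinSq]
  refine Complex.ofReal_ne_zero.2 (pow_ne_zero _ (Real.sin_pos_of_pos_of_lt_pi ?_ ?_).ne')
  · positivity
  · rw [div_lt_iff₀ (by positivity)]
    nlinarith [Real.pi_pos]

/-- With 1 - 2z = cos φ, both alternatives give cos(3Nφ) = 1. The resulting integer is reduced
modulo 3N, and the residue 0 would give z = 0. -/
theorem eq_sinSq_of_chebT (h : chebT N (1 - 2 * z) = 1 ∨ 2 * chebT N (1 - 2 * z) + 1 = 0)
    (hz : z ≠ 0) : ∃ j : ℕ, 1 ≤ j ∧ j ≤ 3 * N - 1 ∧ z = sinSq N j := by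
  have hN : (N : ℂ) ≠ 0 := Nat.cast_ne_zero.2 (NeZero.ne N)
  have hpos : 0 < N := NeZero.pos N
  obtain ⟨φ, hφ⟩ := Complex.cos_surjective (1 - 2 * z)
  have h1 : Complex.cos (3 * (N * φ)) = 1 := by
    rw [Complex.cos_three_mul, ← chebT_cos, hφ]
    rcases h with h | h
    · rw [h]
      norm_num
    · rw [show chebT N (1 - 2 * z) = -1 / 2 by linear_combination h / 2]
      norm_num
  obtain ⟨n, hn⟩ := Complex.cos_eq_one_iff.1 h1
  have hz' : z = Complex.sin (n * Real.pi / (3 * N)) ^ 2 := by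
    have h2 : φ = 2 * (n * Real.pi / (3 * N)) := by
      field_simp
      linear_combination -hn
    rw [h2, Complex.cos_two_mul, Complex.cos_sq'] at hφ
    linear_combination hφ / 2
  set j := (n % (3 * N)).toNat with hj
  have hmod : (0 : ℤ) ≤ n % (3 * N) := Int.emod_nonneg _ (by omega)
  have hlt : n % (3 * N) < 3 * N := Int.emod_lt_of_pos _ (by omega)
  have hjn : (j : ℤ) = n % (3 * N) := Int.toNat_of_nonneg hmod
  have hdiv : n = j + 3 * N * (n / (3 * N)) := by
    rw [hjn]
    exact (Int.emod_add_mul_ediv n (3 * N)).symm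
  have hzj : z = sinSq N j := by
    have hN' : (N : ℝ) ≠ 0 := Nat.cast_ne_zero.2 (NeZero.ne N)
    have h3 : (n : ℝ) * Real.pi / (3 * N) =
        (j : ℝ) * Real.pi / (3 * N) + (n / (3 * N) : ℤ) * Real.pi := by
      have : (n : ℝ) = j + 3 * N * (n / (3 * N) : ℤ) := by exact_mod_cast hdiv
      rw [this]
      field_simp
    have h4 : Real.sin (n * Real.pi / (3 * N)) ^ 2 = Real.sin (j * Real.pi / (3 * N)) ^ 2 := by
      rw [h3, Real.sin_add_int_mul_pi, mul_pow, ← zpow_natCast, ← zpow_mul,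
        mul_comm _ ((2 : ℕ) : ℤ), zpow_mul]
      norm_num
    rw [hz', sinSq, ← h4]
    push_cast
    rfl
  refine ⟨j, ?_, ?_, hzj⟩
  · by_contra h0
    have h0 : j = 0 := by omega
    rw [h0] at hzj
    apply hz
    rw [hzj]
    simp [sinSq]
  · omega

end

end

/-! ### Multiplicities -/

section

/-- The function h on corners, p plus p across the gluing, has zero cell sums and is therefore
orthogonal to p and, by σ-invariance, to p across the gluing. So it is orthogonal to itself, and p
alternates. -/
theorem cellEigen_neg_three {W : Type} [Fintype W] {σ : W × Fin 3 → W × Fin 3} (hσ : IsGluing σ)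
    (hc : IsConnected σ) (hb : HasBoundary σ) : cellEigen σ (-3) = ⊥ := by
  rw [Submodule.eq_bot_iff]
  intro p hp
  rw [mem_cellEigen] at hp
  have e : Function.Bijective σ := Function.Involutive.bijective hσ.involutive
  set h : W × Fin 3 → ℂ := fun a => p a.1 + p (σ a).1 with hh
  have h1 : ∀ c, ∑ k, h (c, k) = 0 := by
    intro c
    simp only [hh, Finset.sum_add_distrib, hp]
    simp
  have h2 : ∑ a, p a.1 * starRingEnd ℂ (h a) = 0 := by
    rw [Fintype.sum_prod_type]
    simp only [← Finset.mul_sum, ← map_sum, h1]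
    simp
  have h3 : ∑ a, p (σ a).1 * starRingEnd ℂ (h a) = 0 := by
    rw [← h2, ← e.sum_comp (fun a => p a.1 * starRingEnd ℂ (h a))]
    refine Finset.sum_congr rfl fun a _ => ?_
    simp only [hh, hσ.involutive, add_comm]
  have h4 : ∑ a, Complex.normSq (h a) = 0 := by
    have : ∑ a, h a * starRingEnd ℂ (h a) = 0 := by
      rw [← add_zero (0 : ℂ)]
      nth_rw 1 [← h2]
      rw [← h3, ← Finset.sum_add_distrib]
      exact Finset.sum_congr rfl fun a _ => by simp only [hh]; ring
    simp only [Complex.mul_conj] at this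
    exact_mod_cast this
  rw [Finset.sum_eq_zero_iff_of_nonneg fun _ _ => Complex.normSq_nonneg _] at h4
  exact hc.eq_zero_of_alternating hb fun c k =>
    Complex.normSq_eq_zero.1 (h4 (c, k) (Finset.mem_univ _))

variable (N : ℕ) [NeZero N]

/-- The multiplicity of `3 - 4 z` as an eigenvalue of the adjacency operator on the cells of
level `n`. -/
noncomputable def cellMult (n : ℕ) (z : ℂ) : ℕ :=
  Module.finrank ℂ (cellEigen (glue N n) (3 - 4 * z))

theorem mult_eq_cellMult (n : ℕ) {z : ℂ} (hz : z ≠ 3 / 2) : mult N n z = cellMult N n z := by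
  rw [mult_eq_finrank_vertexEigen, finrank_vertexEigen (isGluing_glue N n) hz, cellMult]

theorem cellMult_three_halves (n : ℕ) : cellMult N n (3 / 2) = 0 := by
  rw [cellMult, show (3 - 4 * (3 / 2) : ℂ) = -3 by norm_num,
    cellEigen_neg_three (isGluing_glue N n) (isConnected_glue N n) (hasBoundary_glue N n),
    finrank_bot]

theorem three_mul_sub_one_ne_zero : (3 * N - 1 : ℚ) ≠ 0 := by
  have : (1 : ℚ) ≤ N := by exact_mod_cast NeZero.one_le
  linarith

theorem finrank_even_null_glue (n : ℕ) : (Module.finrank ℂ (signedNull (glue N n) 1) : ℚ) =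
    (3 * N + (3 * N - 2) * (3 * N) ^ n) / (3 * N - 1) := by
  have h1 := finrank_even_null (isGluing_glue N n) (isConnected_glue N n) (hasBoundary_glue N n)
  rw [finrank_signed_glue, card_cell] at h1
  have h2 : (Module.finrank ℂ (signedNull (glue N n) 1) : ℚ) + (3 * N) ^ n =
      Fintype.card (V N n) := by exact_mod_cast h1
  have h3 := three_mul_sub_one_ne_zero N
  rw [eq_sub_of_add_eq h2, card_V]
  field_simp
  ring

theorem finrank_odd_null_glue (n : ℕ) : (Module.finrank ℂ (signedNull (glue N n) (-1)) : ℚ) =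
    ((3 * N) ^ n - 1) / (3 * N - 1) := by
  have h1 := finrank_odd_null (isGluing_glue N n) (isConnected_glue N n)
  rw [finrank_signed_glue, card_cell] at h1
  have h2 : (Module.finrank ℂ (signedNull (glue N n) (-1)) : ℚ) + Fintype.card (V N n) =
      2 * (3 * N) ^ n + 1 := by exact_mod_cast h1
  have h3 := three_mul_sub_one_ne_zero N
  rw [eq_sub_of_add_eq h2, card_V]
  field_simp
  ring

theorem mult_three_halves (n : ℕ) : (mult N n (3 / 2) : ℚ) =
    (3 * N + (3 * N - 2) * (3 * N) ^ n) / (3 * N - 1) := by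
  rw [mult_eq_finrank_vertexEigen, vertexEigen_three_halves (isConnected_glue N n)
    (hasBoundary_glue N n), finrank_even_null_glue]

variable {N}

theorem cellMult_succ (n : ℕ) (z : ℂ) : cellMult N (n + 1) z =
    Module.finrank ℂ (cornerData N (glue N n) (1 - 2 * z)) := by
  rw [← finrank_cellEigen_subdivide, cellMult, show 3 - 4 * z = 2 * (1 - 2 * z) + 1 by ring]
  rfl

theorem cellMult_succ_generic (n : ℕ) {z y : ℂ} (hU : chebU N (1 - 2 * z) ≠ 0)
    (hT : 2 * chebT N (1 - 2 * z) + 1 ≠ 0) (hA : polyA N z ≠ 0)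
    (hy : 2 * chebU N (1 - 2 * z) * y = (1 - chebT N (1 - 2 * z)) * polyA N z) :
    cellMult N (n + 1) z = cellMult N n y := by
  rw [cellMult_succ, finrank_cornerData hU, cellMult]
  refine finrank_cornerEigen_generic (isGluing_glue N n) hU hT hA ?_
  rw [polyA] at hy
  linear_combination -2 * hy

theorem cellMult_succ_of_polyA (n : ℕ) {z : ℂ} (hA : polyA N z = 0) :
    (cellMult N (n + 1) z : ℚ) = ((3 * N) ^ n - 1) / (3 * N - 1) := by
  have hU := chebU_ne_zero_of_polyA N z hA
  rw [cellMult_succ, finrank_cornerData hU, cornerEigen_eq_odd_null (isGluing_glue N n)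
    (isConnected_glue N n) hU hA fun hT => polyA_ne_zero_of_chebT N z hT hA,
    finrank_odd_null_glue]

theorem cellMult_succ_of_chebT (n : ℕ) {z : ℂ} (hT : 2 * chebT N (1 - 2 * z) + 1 = 0) :
    (cellMult N (n + 1) z : ℚ) = (3 * N + (3 * N - 2) * (3 * N) ^ n) / (3 * N - 1) := by
  have hU := chebU_ne_zero_of_chebT N _ hT
  rw [cellMult_succ, finrank_cornerData hU, hT, zero_add,
    cornerEigen_eq_even_null (isGluing_glue N n) (isConnected_glue N n) (hasBoundary_glue N n) hU,
    finrank_even_null_glue]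

omit [NeZero N] in
theorem cellMult_zero_level {z : ℂ} (hz : cellMult N 0 z ≠ 0) : z = 0 := by
  by_contra h
  apply hz
  suffices h0 : cellEigen (glue N 0) (3 - 4 * z) = ⊥ by rw [cellMult, h0, finrank_bot]
  rw [Submodule.eq_bot_iff]
  intro p hp
  ext c
  have h1 := hp c
  change ∑ _k : Fin 3, p c = _ at h1
  simp only [Finset.sum_const, Finset.card_univ, Fintype.card_fin, nsmul_eq_mul] at h1
  push_cast at h1
  have h2 : 4 * z * p c = 0 := by linear_combination h1
  simpa [h] using h2

theorem cellMult_zero_aux (n : ℕ) {z : ℂ} (hU : chebU N (1 - 2 * z) ≠ 0)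
    (hT : chebT N (1 - 2 * z) = 1) : cellMult N (n + 1) z = cellMult N n 0 := by
  refine cellMult_succ_generic n hU ?_ (polyA_ne_zero_of_chebT N z hT) ?_
  · rw [hT]
    norm_num
  · rw [hT]
    ring

omit [NeZero N] in
theorem chebT_at_zero : chebT N (1 - 2 * 0) = 1 := by
  rw [mul_zero, sub_zero]
  exact (cheb_one N).1

/-- The point 0 is a generic fixed point of the decimation, as T = 1 and U = N there, so the count
descends to the single cell of level 0. -/
theorem cellMult_zero (n : ℕ) : cellMult N n 0 = 1 := by
  induction n with
  | zero =>
    apply finrank_const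
    intro p
    rw [mem_cellEigen]
    refine ⟨fun _ _ _ => rfl, fun _ c => ?_⟩
    change ∑ _k : Fin 3, p c = _
    simp
  | succ n ih =>
    rw [cellMult_zero_aux n _ chebT_at_zero, ih]
    rw [mul_zero, sub_zero, (cheb_one N).2]
    exact Nat.cast_ne_zero.2 (NeZero.ne N)

theorem harmonic_const (n : ℕ) (q : Cell N n → ℂ)
    (hq : ∀ c, ∑ k, q (glue N n (c, k)).1 = 3 * q c) (c d : Cell N n) : q c = q d := by
  have h1 : Module.finrank ℂ (cellEigen (glue N n) (3 - 4 * 0)) = 1 := cellMult_zero n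
  have hmem : ∀ q : Cell N n → ℂ, (∀ c, ∑ k, q (glue N n (c, k)).1 = 3 * q c) →
      q ∈ cellEigen (glue N n) (3 - 4 * 0) := fun q hq => by
    rw [mul_zero, sub_zero]
    exact hq
  have hne : (⟨fun _ => 1, hmem _ fun c => by simp⟩ : cellEigen (glue N n) (3 - 4 * 0)) ≠ 0 :=
    fun h => one_ne_zero (congrFun (congrArg Subtype.val h) c)
  obtain ⟨r, hr⟩ := (finrank_eq_one_iff_of_nonzero' _ hne).1 h1 ⟨q, hmem q hq⟩
  have hr' : ∀ c, r * 1 = q c := fun c => congrFun (congrArg Subtype.val hr) c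
  rw [← hr' c, ← hr' d]

theorem cellMult_succ_degenerate (n : ℕ) {z : ℂ} (hU : chebU N (1 - 2 * z) = 0)
    (hT : chebT N (1 - 2 * z) = 1) : cellMult N (n + 1) z = (3 * N) ^ n + 1 := by
  rw [cellMult_succ, finrank_cornerData_degenerate (harmonic_const n) hU hT, card_cell]

theorem cellMult_succ_pole (n : ℕ) {z : ℂ} (hU : chebU N (1 - 2 * z) = 0)
    (hT : chebT N (1 - 2 * z) = -1) : cellMult N (n + 1) z = 0 := by
  rw [cellMult_succ, cornerData_eq_bot hU hT, finrank_bot]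

/-! ### Backward orbits -/

variable (N) in
/-- The numbers `sin² (j π / (3 N))`, `1 ≤ j ≤ 3 N - 1`. -/
def sinSqSet : Set ℂ := {z | ∃ j : ℕ, 1 ≤ j ∧ j ≤ 3 * N - 1 ∧ z = sinSq N j}

omit [NeZero N] in
theorem iterPreimage_mono {S S' : Set ℂ} (h : S ⊆ S') (m : ℕ) :
    iterPreimage N m S ⊆ iterPreimage N m S' := by
  induction m with
  | zero => exact h
  | succ m ih => exact fun z hz => ⟨hz.1, ih hz.2⟩

theorem chebT_sinSq_cases (k : ℕ) : chebT N (1 - 2 * sinSq N k) = 1 ∨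
    2 * chebT N (1 - 2 * sinSq N k) + 1 = 0 := by
  by_cases h : 3 ∣ k
  exacts [Or.inl (chebT_sinSq_of_dvd h), Or.inr (chebT_sinSq_of_not_dvd h)]

theorem zero_notMem_iterPreimage (m : ℕ) : (0 : ℂ) ∉ iterPreimage N m (sinSqSet N ∪ setA N) := by
  induction m with
  | zero =>
    rintro (⟨j, h1, h2, h3⟩ | h)
    · exact sinSq_ne_zero h1 h2 h3.symm
    · exact polyA_ne_zero_of_chebT N 0 chebT_at_zero h
  | succ m ih =>
    rintro ⟨-, h⟩
    rw [R_eq_zero_of_chebT N 0 chebT_at_zero] at h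
    exact ih h

omit [NeZero N] in
-- If U = 0 and T = -1, then `R_mul` would read 0 = -2; such z are poles.
theorem chebU_ne_zero_of_denR {z : ℂ} (hd : denR N z ≠ 0) (hT : chebT N (1 - 2 * z) ≠ 1) :
    chebU N (1 - 2 * z) ≠ 0 := by
  intro hU
  have hT' := (chebT_sq_of_chebU N _ hU).resolve_left hT
  have := R_mul N z hd
  rw [polyA, hU, hT'] at this
  norm_num at this

theorem cellMult_succ_of_denR (n : ℕ) {z : ℂ} (hd : denR N z ≠ 0)
    (hT : chebT N (1 - 2 * z) ≠ 1) (hT' : 2 * chebT N (1 - 2 * z) + 1 ≠ 0) (hA : polyA N z ≠ 0) :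
    cellMult N (n + 1) z = cellMult N n (R N z) :=
  cellMult_succ_generic n (chebU_ne_zero_of_denR hd hT) hT' hA (R_mul N z hd)

theorem even_null_pos (n : ℕ) :
    (0 : ℚ) < (3 * N + (3 * N - 2) * (3 * N) ^ n) / (3 * N - 1) := by
  have : (1 : ℚ) ≤ N := by exact_mod_cast NeZero.one_le
  have h1 : (0 : ℚ) < (3 * N) ^ n := by positivity
  apply div_pos
  · nlinarith
  · linarith

theorem odd_null_pos {n : ℕ} (hn : 1 ≤ n) : (0 : ℚ) < ((3 * N) ^ n - 1) / (3 * N - 1) := by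
  have h : (1 : ℚ) ≤ N := by exact_mod_cast NeZero.one_le
  have h1 : (1 : ℚ) < (3 * N) ^ n := one_lt_pow₀ (by linarith) (by omega)
  apply div_pos <;> linarith

theorem cellMult_succ_ne_zero {n : ℕ} (hn : 1 ≤ n) {z : ℂ}
    (h : chebT N (1 - 2 * z) = 1 ∨ 2 * chebT N (1 - 2 * z) + 1 = 0 ∨ polyA N z = 0) :
    cellMult N (n + 1) z ≠ 0 := by
  rcases h with h | h | h
  · by_cases hU : chebU N (1 - 2 * z) = 0
    · rw [cellMult_succ_degenerate n hU h]
      omega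
    · rw [cellMult_zero_aux n hU h, cellMult_zero]
      exact one_ne_zero
  · have := even_null_pos (N := N) n
    rw [← cellMult_succ_of_chebT n h] at this
    exact_mod_cast this.ne'
  · have := odd_null_pos (N := N) hn
    rw [← cellMult_succ_of_polyA n h] at this
    exact_mod_cast this.ne'

/-- Descent along R stops as soon as an exceptional value appears, because every exceptional value
other than a pole has positive multiplicity at level 2 and above. The orbit need not be known to
avoid such values. -/
theorem cellMult_ne_zero_of_mem {m n : ℕ} (hn : m + 1 ≤ n) {z : ℂ}
    (hz : z ∈ iterPreimage N m (sinSqSet N ∪ setA N)) : cellMult N (n + 1) z ≠ 0 := by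
  induction m generalizing n z with
  | zero =>
    apply cellMult_succ_ne_zero hn
    rcases hz with ⟨j, -, -, rfl⟩ | h
    · rcases chebT_sinSq_cases (N := N) j with h | h
      exacts [Or.inl h, Or.inr (Or.inl h)]
    · exact Or.inr (Or.inr h)
  | succ m ih =>
    by_cases h : chebT N (1 - 2 * z) = 1 ∨ 2 * chebT N (1 - 2 * z) + 1 = 0 ∨ polyA N z = 0
    · exact cellMult_succ_ne_zero (by omega) h
    · push Not at h
      rw [cellMult_succ_of_denR n hz.1 h.1 h.2.1 h.2.2]
      obtain ⟨n, rfl⟩ := Nat.exists_eq_add_of_lt hn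
      exact ih (by omega) hz.2

/-- Membership would force a nonzero cell eigenfunction for 3 - 4z = -3, and there is none. -/
theorem three_halves_notMem_iterPreimage (m : ℕ) :
    (3 / 2 : ℂ) ∉ iterPreimage N m (sinSqSet N ∪ setA N) := fun h =>
  cellMult_ne_zero_of_mem le_rfl h (cellMult_three_halves N _)

/-- Each step is generic: an exceptional z would have R z equal to 0 or 3/2, neither of which lies
in the remaining iterated preimage. -/
theorem cellMult_add {S : Set ℂ} (hS : S ⊆ sinSqSet N ∪ setA N) (m n : ℕ) {z : ℂ}
    (hz : z ∈ iterPreimage N m S) : ∃ y ∈ S, cellMult N (n + m) z = cellMult N n y := by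
  induction m generalizing z with
  | zero => exact ⟨z, hz, rfl⟩
  | succ m ih =>
    obtain ⟨hd, hR⟩ := hz
    obtain ⟨y, hy, h⟩ := ih hR
    refine ⟨y, hy, ?_⟩
    have hR' := iterPreimage_mono hS m hR
    rw [← add_assoc, ← h]
    apply cellMult_succ_of_denR _ hd
    · intro hT
      rw [R_eq_zero_of_chebT N z hT] at hR'
      exact zero_notMem_iterPreimage m hR'
    · intro hT
      rw [R_eq_three_halves N z hT hd] at hR'
      exact three_halves_notMem_iterPreimage m hR'
    · intro hA
      rw [R_eq_zero_of_polyA N z hA] at hR'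
      exact zero_notMem_iterPreimage m hR'

theorem mult_of_mem {S : Set ℂ} (hS : S ⊆ sinSqSet N ∪ setA N) {m n : ℕ} (hmn : m < n) {z : ℂ}
    (hz : z ∈ iterPreimage N m S) : ∃ y ∈ S, mult N n z = cellMult N (n - m - 1 + 1) y := by
  obtain ⟨y, hy, h⟩ := cellMult_add hS m (n - m - 1 + 1) hz
  refine ⟨y, hy, ?_⟩
  rw [mult_eq_cellMult, ← h, show n - m - 1 + 1 + m = n by omega]
  rintro rfl
  exact three_halves_notMem_iterPreimage m (iterPreimage_mono hS m hz)

theorem mult_of_mem_setA {m n : ℕ} (hmn : m < n) {z : ℂ} (hz : z ∈ iterPreimage N m (setA N)) :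
    (mult N n z : ℚ) = ((3 * N) ^ (n - m - 1) - 1) / (3 * N - 1) := by
  obtain ⟨y, hy, h⟩ := mult_of_mem Set.subset_union_right hmn hz
  rw [h, cellMult_succ_of_polyA _ hy]

theorem mult_of_mem_sinSq {m n k : ℕ} (hmn : m < n) (h1 : 1 ≤ k) (h2 : k ≤ 3 * N - 1) {z : ℂ}
    (hz : z ∈ iterPreimage N m {sinSq N k}) :
    mult N n z = cellMult N (n - m - 1 + 1) (sinSq N k) := by
  obtain ⟨y, rfl, h⟩ := mult_of_mem (S := {sinSq N k})
    (Set.singleton_subset_iff.2 (Or.inl ⟨k, h1, h2, rfl⟩)) hmn hz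
  exact h

theorem mem_of_cellMult_ne_zero {n : ℕ} {z : ℂ} (h : cellMult N n z ≠ 0) :
    z = 0 ∨ (∃ m < n, z ∈ iterPreimage N m (sinSqSet N)) ∨
      ∃ m, m + 1 < n ∧ z ∈ iterPreimage N m (setA N) := by
  induction n generalizing z with
  | zero => exact Or.inl (cellMult_zero_level h)
  | succ n ih =>
    by_cases hz : z = 0
    · exact Or.inl hz
    right
    by_cases hT : chebT N (1 - 2 * z) = 1 ∨ 2 * chebT N (1 - 2 * z) + 1 = 0
    · exact Or.inl ⟨0, Nat.succ_pos n, eq_sinSq_of_chebT hT hz⟩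
    push Not at hT
    by_cases hA : polyA N z = 0
    · refine Or.inr ⟨0, ?_, hA⟩
      -- At level 1 the space of odd functions for the single coarse cell is zero; this is why 𝒜
      -- enters only for m + 1 < n.
      by_contra hn
      obtain rfl : n = 0 := by omega
      have := cellMult_succ_of_polyA 0 hA
      rw [pow_zero, sub_self, zero_div] at this
      exact h (by exact_mod_cast this)
    have hU : chebU N (1 - 2 * z) ≠ 0 := fun hU =>
      h (cellMult_succ_pole n hU ((chebT_sq_of_chebU N _ hU).resolve_left hT.1))
    have hd := denR_ne_zero N z hz hU
    rw [cellMult_succ_of_denR n hd hT.1 hT.2 hA] at h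
    rcases ih h with h0 | ⟨m, hm, hm'⟩ | ⟨m, hm, hm'⟩
    · have := R_mul N z hd
      rw [h0, mul_zero, eq_comm, mul_eq_zero] at this
      exact absurd (sub_eq_zero.1 (this.resolve_right hA)).symm hT.1
    · exact Or.inl ⟨m + 1, by omega, hd, hm'⟩
    · exact Or.inr ⟨m + 1, by omega, hd, hm'⟩

theorem mem_eigenvalues_iff (n : ℕ) (z : ℂ) : z ∈ eigenvalues N n ↔ mult N n z ≠ 0 := by
  rw [eigenvalues, Set.mem_ofPred_eq, Module.End.hasEigenvalue_iff, mult, Ne, Ne,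
    Submodule.finrank_eq_zero]

theorem mult_zero (n : ℕ) : mult N n 0 = 1 := by
  rw [mult_eq_cellMult N n (by norm_num), cellMult_zero]

end

end GasketSpectrum

open GasketSpectrum in
theorem theorem4 (N : ℕ) [NeZero N] (n : ℕ) :
    -- the dimension of the matrix
    (Fintype.card (V N n) : ℚ) = (3 * N + (6 * N - 3) * (3 * N) ^ n) / (3 * N - 1) ∧
    -- the set of eigenvalues
    eigenvalues N n =
      {0, 3 / 2}
        ∪ (⋃ m : ℕ, ⋃ _ : m < n,
            iterPreimage N m {z | ∃ j : ℕ, 1 ≤ j ∧ j ≤ 3 * N - 1 ∧ z = sinSq N j})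
        ∪ (⋃ m : ℕ, ⋃ _ : m + 1 < n, iterPreimage N m (setA N)) ∧
    -- the multiplicities of `0` and `3 / 2`
    mult N n 0 = 1 ∧
    (mult N n (3 / 2) : ℚ) = (3 * N + (3 * N - 2) * (3 * N) ^ n) / (3 * N - 1) ∧
    -- the multiplicity of `z` with `R^m z = sin² (k π / (3N))`
    (∀ m : ℕ, m < n → ∀ k : ℕ, 1 ≤ k → k ≤ 3 * N - 1 →
      ∀ z ∈ iterPreimage N m {sinSq N k},
        (¬ 3 ∣ k →
          (mult N n z : ℚ) =
            (3 * N + (3 * N - 2) * (3 * N) ^ (n - m - 1)) / (3 * N - 1)) ∧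
        (3 ∣ k → 2 * k ≠ 3 * N → mult N n z = (3 * N) ^ (n - m - 1) + 1) ∧
        (2 * k = 3 * N → mult N n z = 1)) ∧
    -- the multiplicity of `z` with `R^m z ∈ 𝒜`
    (∀ m : ℕ, m < n → ∀ z ∈ iterPreimage N m (setA N),
      (mult N n z : ℚ) = ((3 * N) ^ (n - m - 1) - 1) / (3 * N - 1)) := by
  refine ⟨card_V n, ?_, mult_zero n, mult_three_halves N n, fun m hm k h1 h2 z hz => ?_,
    fun m hm z hz => mult_of_mem_setA hm hz⟩
  · ext z
    rw [mem_eigenvalues_iff]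
    simp only [Set.mem_union, Set.mem_insert_iff, Set.mem_singleton_iff, Set.mem_iUnion,
      exists_prop]
    constructor
    · intro h
      by_cases hz : z = 3 / 2
      · exact Or.inl (Or.inl (Or.inr hz))
      rw [mult_eq_cellMult N n hz] at h
      rcases mem_of_cellMult_ne_zero h with h | h | h
      exacts [Or.inl (Or.inl (Or.inl h)), Or.inl (Or.inr h), Or.inr h]
    · rintro (((rfl | rfl) | ⟨m, hm, hz⟩) | ⟨m, hm, hz⟩)
      · rw [mult_zero]
        exact one_ne_zero
      · have := even_null_pos (N := N) n
        rw [← mult_three_halves] at this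
        exact_mod_cast this.ne'
      · obtain ⟨y, ⟨j, h1, h2, rfl⟩, h⟩ := mult_of_mem (S := sinSqSet N)
          Set.subset_union_left hm hz
        rw [h]
        rcases chebT_sinSq_cases (N := N) j with hT | hT
        · by_cases hU : chebU N (1 - 2 * sinSq N j) = 0
          · rw [cellMult_succ_degenerate _ hU hT]
            exact Nat.succ_ne_zero _
          · rw [cellMult_zero_aux _ hU hT, cellMult_zero]
            exact one_ne_zero
        · have := even_null_pos (N := N) (n - m - 1)
          rw [← cellMult_succ_of_chebT _ hT] at this
          exact_mod_cast this.ne'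
      · have := odd_null_pos (N := N) (n := n - m - 1) (by omega)
        rw [← mult_of_mem_setA (by omega) hz] at this
        exact_mod_cast this.ne'
  · rw [mult_of_mem_sinSq hm h1 h2 hz]
    refine ⟨fun h3 => cellMult_succ_of_chebT _ (chebT_sinSq_of_not_dvd h3), fun h3 h4 =>
      cellMult_succ_degenerate _ (chebU_sinSq_eq_zero h3 h1 h2 h4) (chebT_sinSq_of_dvd h3),
      fun h4 => ?_⟩
    -- Here the value is z = 1, where T = 1 but U = ±N ≠ 0, so the generic step leads to the simple
    -- eigenvalue 0.
    have h3 : 3 ∣ k := by omega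
    have hT := chebT_sinSq_of_dvd (N := N) h3
    rw [sinSq_of_two_mul h4] at hT ⊢
    rw [cellMult_zero_aux _ chebU_neg_one_ne_zero hT, cellMult_zero]
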